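/- An index coding problem with $m$ decoders consists of a source $\mathbf S$ of $s$ i.i.d. Bernoulli$(1/2)$ bits and, for each decoder $\alpha\in[m]$, a set $\mathbf Y_\alpha$ of source bits known to it (side information) and a set $\mathbf f_\alpha$ of source bits it demands, where $\mathbf f_\alpha\cap\mathbf Y_\alpha=\emptyset$, the sets $\mathbf Y_\alpha$ are pairwise distinct, and every source bit is demanded by at least one decoder. An $(n,M)$ code has an encoder mapping $n$ i.i.d. copies of $\mathbf S$ to $\{1,\dots,M\}$ and, for each $\alpha$, a decoder that maps the codeword and the $n$ copies of $\mathbf Y_\alpha$ to an estimate of the $n$ copies of $\mathbf f_\alpha$. A rate $R$ is achievable if there are $(n,M_n)$ codes, $n\ge 1$, with $n^{-1}\log_2 M_n\le R$ for which the probability that some decoder errs tends to $0$ as $n\to\infty$; $R_{opt}$ is the infimum of the achievable rates. For $I,J\subseteq[m]$ let $f_{IJ}$ be the set of source bits that are demanded exactly by the decoders in $I$ and are absent from the side information exactly of the decoders in $J$. $H$ denotes entropy in bits. For every index coding problem with $m\le 3$ decoders and any number $s$ of source bits, $$R_{opt}=\max\{R_1,\dots,R_m\},$$ where, with $\tilde{\mathbf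 f}_a=\mathbf f_a\setminus\bigcup_{\beta\ne a}f_{\{a\}\{a,\beta\}}$, $$R_i=H\big(\mathbf f_i,(\tilde{\mathbf f}_a)_{a\ne i}\,\big|\,\mathbf Y_i\big)+\max_{j\in[m]\setminus\{i\}}|f_{\{j\}\{i,j\}}|$$ (a maximum over the empty set is $0$). This rate is an integer, and it is achieved by CAPM (coded approximate partition multicast), the following procedure. CAPM chooses random vectors $U_I$, $I\subseteq[m]$ (of level $|I|$). Step 1: each source bit, lying in a unique $f_{KJ}$, is put in $U_{K\cup J^c}$ if $J\ne[m]$ and in $U_{[m]}$ if $J=[m]$. Step 2: the $U_I$ with $I\neq[m]$ are processed in order of increasing level (arbitrarily within a level). To process $U_I$, let $i^*$ and $j^*$ be the least indices in $I$ at which $H(U_I|\mathbf Y_l)$, $l\in I$, is minimal and maximal; while these two entropies differ, move the lowest-index bit of $U_I$ that is in $\mathbf Y_{i^*}$ but not in $\mathbf Y_{j^*}$ to $U_{I\cup\{j\}}$, where $j$ is the least index outside $I$ such that $U_{I\cup\{j\}}$ is nonempty or, if there is none, the least index outside $I$; then recompute $i^*,j^*$. Bits moved in this step are called excess. Step 3: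 as long as some $U_I$ contains two components, each an excess bit or a sum of excess bits, all originating from the same vector of Step 1, such that every decoder that demands a bit of one of the two has all bits of the other as side information, replace the two by their mod-2 sum. Precisely: CAPM has an output, and for each of its possible outputs $(U_I)$ the following hold. (a) The output is feasible: every decoder $i$ can compute $\mathbf f_i$ from $\mathbf Y_i$ and the $U_I$ with $i\in I$; the $U_I$ are mutually independent; any two disjoint collections of the $U_I$ are conditionally independent given any collection of the $U_I$ and any collection of the $\mathbf Y_i$; and every component of every $U_I$ is a mod-2 sum of source bits. (b) Its rate $\sum_{I\subseteq[m]}\max_{i\in I}H(U_I|\mathbf Y_i)$ equals $R_{opt}$. (c) This rate is achievable. -/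

import Mathlib

open Filter Topology

noncomputable section

namespace IndexCoding

/-! ### Probability and entropy under the uniform distribution on a finite sample space -/

open Classical in
/-- Probability of the event `p` under the uniform distribution on `Ω`.  With
`Ω = (Fin s → ZMod 2)` or `Ω = (Fin n → Fin s → ZMod 2)` this is the law of i.i.d.
Bernoulli(1/2) bits. -/
def prob {Ω : Type*} [Fintype Ω] (p : Ω → Prop) : ℝ :=
  ((Finset.univ.filter p).card : ℝ) / (Fintype.card Ω : ℝ)

/-- Shannon conditional entropy `H(X | Z) = 𝔼[-log₂ P(X | Z)]`, in bits. -/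
def condEntropy {Ω A B : Type*} [Fintype Ω] (X : Ω → A) (Z : Ω → B) : ℝ :=
  (∑ ω : Ω, -Real.logb 2
      (prob (fun ω' => X ω' = X ω ∧ Z ω' = Z ω) / prob (fun ω' => Z ω' = Z ω))) /
    (Fintype.card Ω : ℝ)

/-- Mutual independence of a finite family of random variables. -/
def MutuallyIndep {Ω ι : Type*} [Fintype Ω] [Fintype ι] {A : ι → Type*}
    (X : ∀ i, Ω → A i) : Prop :=
  ∀ x : ∀ i, A i, prob (fun ω => ∀ i, X i ω = x i) = ∏ i, prob (fun ω => X i ω = x i)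

/-- `X` and `Y` are conditionally independent given `Z`. -/
def CondIndep {Ω A B C : Type*} [Fintype Ω] (X : Ω → A) (Y : Ω → B) (Z : Ω → C) : Prop :=
  ∀ (a : A) (b : B) (c : C),
    prob (fun ω => X ω = a ∧ Y ω = b ∧ Z ω = c) * prob (fun ω => Z ω = c) =
      prob (fun ω => X ω = a ∧ Z ω = c) * prob (fun ω => Y ω = b ∧ Z ω = c)

/-! ### Index coding problems -/

/-- One realization of the source: `s` bits. -/
abbrev Source (s : ℕ) : Type := Fin s → ZMod 2

/-- The subvector of the source consisting of the bits in `T`. -/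
def bits {s : ℕ} (T : Finset (Fin s)) (S : Source s) : T → ZMod 2 := fun b => S b

end IndexCoding

open IndexCoding

/-- A (groupcast) index coding problem with `m` decoders and `s` source bits: Decoder `α` has
the bits in `side α` as side information and demands the bits in `demand α`.  No decoder demands
a bit of its own side information, distinct decoders have distinct side information, and every
source bit is demanded by at least one decoder. -/
structure IndexCodingProblem (m s : ℕ) where
  side : Fin m → Finset (Fin s)
  demand : Fin m → Finset (Fin s)
  demand_disjoint_side : ∀ α, Disjoint (demand α) (side α)
  side_injective : Function.Injective side
  demanded : ∀ b, ∃ α, b ∈ demand α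

namespace IndexCodingProblem

variable {m s : ℕ} (P : IndexCodingProblem m s)

/-! ### Block codes and the optimal rate -/

/-- An `(n, M)` code: an encoder and one decoding function for each decoder. -/
structure Code (n M : ℕ) where
  enc : (Fin n → Source s) → Fin M
  dec : ∀ α : Fin m, Fin M → (Fin n → (P.side α → ZMod 2)) → (Fin n → (P.demand α → ZMod 2))

variable {P} in
/-- Block error probability: some decoder fails to reproduce its demands. -/
def Code.errorProb {n M : ℕ} (c : P.Code n M) : ℝ :=
  prob (fun S : Fin n → Source s =>
    ∃ α, c.dec α (c.enc S) (fun t => bits (P.side α) (S t)) ≠ fun t => bits (P.demand α) (S t))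

/-- `R` (in bits per source symbol) is achievable: there is a sequence of `(n, M n)` codes of rate
at most `R` whose block error probability vanishes. -/
def Achievable (R : ℝ) : Prop :=
  ∃ (M : ℕ → ℕ) (c : ∀ n, P.Code n (M n)),
    (∀ n, 1 ≤ n → Real.logb 2 (M n : ℝ) / (n : ℝ) ≤ R) ∧
      Tendsto (fun n => (c n).errorProb) atTop (𝓝 0)

/-- The optimal rate, the infimum of the achievable rates. -/
def optimalRate : ℝ := sInf {R : ℝ | P.Achievable R}

/-! ### The demand components `f_{IJ}` and the rate formula -/

/-- The decoders that do not have bit `b` as side information. -/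
def missing (b : Fin s) : Finset (Fin m) := Finset.univ.filter (fun α => b ∉ P.side α)

/-- The decoders that demand bit `b`. -/
def demanders (b : Fin s) : Finset (Fin m) := Finset.univ.filter (fun α => b ∈ P.demand α)

/-- `f_{IJ}`: the bits that are missing exactly at the decoders in `J` and demanded exactly by the
decoders in `I`. -/
def f (I J : Finset (Fin m)) : Finset (Fin s) :=
  Finset.univ.filter (fun b => P.demanders b = I ∧ P.missing b = J)

/-- `f_α ∖ ⋃_{β ≠ α} f_{α{α,β}}`. -/
def reducedDemand (α : Fin m) : Finset (Fin s) :=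
  P.demand α \ (Finset.univ.erase α).biUnion (fun β => P.f {α} {α, β})

/-- `R_i = H(f_i, (f_a ∖ ⋃_{β ≠ a} f_{a{a,β}})_{a ≠ i} | Y_i) + max_{j ≠ i} |f_{j{i,j}}|`, where the
maximum over an empty set of indices (one decoder) is `0`. -/
def rateAt (i : Fin m) : ℝ :=
  condEntropy (bits (P.demand i ∪ (Finset.univ.erase i).biUnion P.reducedDemand))
      (bits (P.side i)) +
    (((Finset.univ.erase i).sup (fun j => (P.f {j} {i, j}).card) : ℕ) : ℝ)

/-- `max {R_1, …, R_m}`. -/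
def maxRate : ℝ := ⨆ i : Fin m, P.rateAt i

end IndexCodingProblem

/-! ### Auxiliary random variables -/

/-- A choice of auxiliary random variables `U_I`, `I ⊆ [m]`: each `U_I` is a vector of bits, each of
which is the mod-2 sum of a set of source bits.  `U I` lists these sets. -/
abbrev AuxChoice (m s : ℕ) : Type := Finset (Fin m) → Finset (Finset (Fin s))

/-- The random vector `U_I` as a function of the source. -/
def AuxChoice.var {m s : ℕ} (U : AuxChoice m s) (I : Finset (Fin m)) (S : Source s) :
    U I → ZMod 2 :=
  fun V => ∑ b ∈ V.1, S b

namespace IndexCodingProblem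

variable {m s : ℕ} (P : IndexCodingProblem m s)

/-- The joint random vector `(U_I)_{I ∈ J}`. -/
def jointVar (U : AuxChoice m s) (J : Finset (Finset (Fin m))) (S : Source s) :
    ∀ I : J, (U I → ZMod 2) :=
  fun I => U.var I S

/-- The joint side information `(Y_i)_{i ∈ T}`. -/
def jointSide (T : Finset (Fin m)) (S : Source s) : ∀ i : T, (P.side i → ZMod 2) :=
  fun i => bits (P.side i) S

/-- Feasibility of a choice of auxiliary random variables: every Decoder `i` can compute its demands
from its side information and the `U_I` with `i ∈ I`; the `U_I` are independent; and disjoint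
collections of them are conditionally independent given any collection of the `U_I` and any
collection of the side information vectors. -/
structure Feasible (U : AuxChoice m s) : Prop where
  decodable : ∀ i : Fin m,
    ∃ g : (∀ I : (Finset.univ.filter (fun I : Finset (Fin m) => i ∈ I)), (U I → ZMod 2)) →
        (P.side i → ZMod 2) → (P.demand i → ZMod 2),
      ∀ S : Source s,
        g (jointVar U (Finset.univ.filter (fun I : Finset (Fin m) => i ∈ I)) S)
          (bits (P.side i) S) = bits (P.demand i) S
  indep : MutuallyIndep (fun I : Finset (Fin m) => U.var I)
  condIndep : ∀ (J K L : Finset (Finset (Fin m))) (T : Finset (Fin m)), Disjoint J K →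
    CondIndep (jointVar U J) (jointVar U K) (fun S => (jointVar U L S, P.jointSide T S))

/-- The rate `∑_I max_{i ∈ I} H(U_I | Y_i)` of a choice of auxiliary random variables (the maximum
over the empty set `I` is `0`). -/
def auxRate (U : AuxChoice m s) : ℝ :=
  ∑ I : Finset (Fin m), ⨆ i : I, condEntropy (U.var I) (bits (P.side i))

/-! ### CAPM, Steps 1 and 2: allocating the source bits

During Steps 1 and 2 each source bit is included in exactly one message `U_I`; an allocation
`a : Fin s → Finset (Fin m)` records that bit `b` is included in `U_{a b}`. -/

/-- Step 1: a bit in `f_{KJ}` is placed in `U_{K ∪ Jᶜ}` if `J ≠ [m]`, and in `U_{[m]}` otherwise. -/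
def step1 (b : Fin s) : Finset (Fin m) :=
  if P.missing b = Finset.univ then Finset.univ else P.demanders b ∪ (P.missing b)ᶜ

/-- The source bits included in `U_I`. -/
def content (a : Fin s → Finset (Fin m)) (I : Finset (Fin m)) : Finset (Fin s) :=
  Finset.univ.filter (fun b => a b = I)

/-- `H(U_I | Y_i)` for the allocation `a`. -/
def need (a : Fin s → Finset (Fin m)) (I : Finset (Fin m)) (i : Fin m) : ℝ :=
  condEntropy (bits (content a I)) (bits (P.side i))

/-- `J` is the next-level message to which an excess bit of `U_I` is moved: `J = I ∪ {j}`, with the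
lowest `j ∉ I` for which `U_J` is nonempty if there is one, and the lowest `j ∉ I` otherwise. -/
def IsNext (a : Fin s → Finset (Fin m)) (I J : Finset (Fin m)) : Prop :=
  ∃ j : Fin m, J = insert j I ∧
    (IsLeast {k | k ∉ I ∧ (content a (insert k I)).Nonempty} j ∨
      ((¬ ∃ k, k ∉ I ∧ (content a (insert k I)).Nonempty) ∧ IsLeast {k | k ∉ I} j))

/-- One move of Step 2 at the message `U_I`: if `H(U_I | Y_{i*}) < H(U_I | Y_{j*})`, where `i*`
(`j*`) is the lowest index in `I` at which the minimum (maximum) of `H(U_I | Y_l)`, `l ∈ I`, is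
attained, then the lowest-index bit of `U_I` that is in `Y_{i*}` but not in `Y_{j*}` is moved to the
next-level message. -/
def Move (I : Finset (Fin m)) (a a' : Fin s → Finset (Fin m)) : Prop :=
  ∃ (i j : Fin m) (b : Fin s) (J : Finset (Fin m)),
    IsLeast {k | k ∈ I ∧ ∀ l ∈ I, P.need a I k ≤ P.need a I l} i ∧
    IsLeast {k | k ∈ I ∧ ∀ l ∈ I, P.need a I l ≤ P.need a I k} j ∧
    P.need a I i < P.need a I j ∧
    IsLeast {b | b ∈ content a I ∧ b ∈ P.side i ∧ b ∉ P.side j} b ∧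
    IsNext a I J ∧
    a' = Function.update a b J

/-- Processing the message `U_I` in Step 2: moves are made until none is possible. -/
def Settle (I : Finset (Fin m)) (a a' : Fin s → Finset (Fin m)) : Prop :=
  Relation.ReflTransGen (P.Move I) a a' ∧ ∀ a'', ¬ P.Move I a' a''

/-- Step 2: the messages in the list are processed one after the other. -/
def Step2 : List (Finset (Fin m)) → (Fin s → Finset (Fin m)) → (Fin s → Finset (Fin m)) → Prop
  | [], a, a' => a' = a
  | I :: L, a, a' => ∃ a₁, P.Settle I a a₁ ∧ Step2 L a₁ a'

/-- A processing order for Step 2: the messages `U_I` with `I ≠ [m]`, sorted by level `|I|` and in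
any order inside a level.  (Empty messages may be listed; nothing is moved out of them.) -/
def IsOrder (L : List (Finset (Fin m))) : Prop :=
  L.Nodup ∧ (∀ I, I ∈ L ↔ I ≠ Finset.univ) ∧ L.Pairwise (fun I J => I.card ≤ J.card)

/-! ### CAPM, Step 3: exclusive-ORing excess bits -/

/-- The decoders that need some bit of the sum over `V`. -/
def needers (V : Finset (Fin s)) : Finset (Fin m) :=
  Finset.univ.filter (fun α => ∃ b ∈ V, b ∈ P.demand α)

/-- The decoders that have all bits of the sum over `V` as side information. -/
def havers (V : Finset (Fin s)) : Finset (Fin m) :=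
  Finset.univ.filter (fun α => ∀ b ∈ V, b ∈ P.side α)

/-- One exclusive-OR in a message whose current components are the mod-2 sums over the sets in `C`,
where `a` is the allocation after Step 2: two distinct components `V`, `W` that consist of excess
bits (bits moved in Step 2), that originate from the same message of Step 1, and each of which is
available at all decoders that need the other one, are replaced by their sum. -/
def XorStep (a : Fin s → Finset (Fin m)) (C C' : Finset (Finset (Fin s))) : Prop :=
  ∃ V ∈ C, ∃ W ∈ C, V ≠ W ∧
    (∀ b ∈ V ∪ W, a b ≠ P.step1 b) ∧
    (∃ O : Finset (Fin m), ∀ b ∈ V ∪ W, P.step1 b = O) ∧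
    P.needers V ⊆ P.havers W ∧ P.needers W ⊆ P.havers V ∧
    C' = insert (V ∪ W) ((C.erase V).erase W)

/-- Step 3 for one message: exclusive-ORs are made until none is possible. -/
def Step3 (a : Fin s → Finset (Fin m)) (C C' : Finset (Finset (Fin s))) : Prop :=
  Relation.ReflTransGen (P.XorStep a) C C' ∧ ∀ C'', ¬ P.XorStep a C' C''

/-- `U` is a choice of auxiliary random variables produced by CAPM.  The order inside a level in
Step 2 and the order of the exclusive-ORs in Step 3 are not prescribed. -/
def IsCAPMOutput (U : AuxChoice m s) : Prop :=
  ∃ (L : List (Finset (Fin m))) (a : Fin s → Finset (Fin m)),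
    IsOrder L ∧ P.Step2 L P.step1 a ∧
      ∀ I, P.Step3 a ((content a I).image (fun b => {b})) (U I)

end IndexCodingProblem

end

/-! The CAPM rate is squeezed between two copies of `maxRate`. With at most three decoders every
CAPM message turns out to be a plain set of source bits, so all entropies are cardinalities and the
argument is a count.

Converse. Fix `i` and a maximizing `j`. Decoder `i` knows no bit of the union of `baseBits i` and `f
{j} {i, j}`; decoder `j` knows only those demanded by `i`, because a bit known to `j` and missing
exactly at `i` and its only demander was removed from the reduced demands; the third decoder knows
only bits demanded by `i` or `j`. So the union can be decoded in the order `i`, `j`, third decoder,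
and the acyclic-set bound `card_le_of_achievable` gives `R_i ≤ R`.

Achievability. A message whose bits are missed at most `k` at a time by its at most three recipients
can be sent with `k` linear combinations, even over the field with two elements
(`exists_linearIndepOn`).

CAPM. By `step1_cases`, a bit left out of the top message `U_[m]` by Step 1 lies in a message `{d,
c}`, where only `d` demands it and only `c` knows it. A move out of this message therefore goes to
the top and takes a bit demanded by the decoder that misses more (`Move.exists_excess`). So all
excess bits of one message share their demander, no two can be added in Step 3, and every message
below the top ends balanced. Now let `i` miss the most bits of the top message, and let `j` be the
demander of the excess bits from the message without `i`. The total cost is what `i` misses in its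
messages plus what `j` misses in the remaining one, and all these bits lie in the union above
(`mem_baseBits_union`); hence the cost is at most `R_i`. -/

noncomputable section

/-! ### Entropy and independence of vectors of source bits -/

namespace IndexCoding

/-- `X` reveals exactly the source bits in `A`. -/
def RevealsExactly {s : ℕ} {β : Type*} (X : Source s → β) (A : Finset (Fin s)) : Prop :=
  ∀ S S', X S = X S' ↔ ∀ b ∈ A, S b = S' b

lemma exists_factor {Ω α β γ : Type*} [Inhabited γ] {X : Ω → α} {Y : Ω → β} {Z : Ω → γ}
    (h : ∀ ω ω', X ω = X ω' → Y ω = Y ω' → Z ω = Z ω') :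
    ∃ g : α → β → γ, ∀ ω, g (X ω) (Y ω) = Z ω := by
  classical
  refine ⟨fun x y => if h : ∃ ω, X ω = x ∧ Y ω = y then Z h.choose else default, fun ω => ?_⟩
  have hex : ∃ ω', X ω' = X ω ∧ Y ω' = Y ω := ⟨ω, rfl, rfl⟩
  simp only [dif_pos hex]
  exact h _ _ hex.choose_spec.1 hex.choose_spec.2

lemma prob_congr {Ω : Type*} [Fintype Ω] {p q : Ω → Prop} (h : ∀ ω, p ω ↔ q ω) :
    prob p = prob q := by
  have : p = q := funext fun ω => propext (h ω)
  rw [this]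

lemma prob_eq_zero {Ω : Type*} [Fintype Ω] {p : Ω → Prop} (h : ∀ ω, ¬ p ω) : prob p = 0 := by
  classical
  unfold prob
  rw [Finset.filter_false_of_mem (fun ω _ => h ω)]
  simp

/-- Prescribing the bits in `A` leaves the other bits free. -/
lemma card_filter_agree {s : ℕ} (A : Finset (Fin s)) (y : Source s) :
    (Finset.univ.filter (fun S : Source s => ∀ b ∈ A, S b = y b)).card = 2 ^ (s - A.card) := by
  classical
  have : (Finset.univ.filter (fun S : Source s => ∀ b ∈ A, S b = y b)) =
      Fintype.piFinset (fun b => if b ∈ A then {y b} else Finset.univ) := by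
    ext S
    simp only [Finset.mem_filter, Finset.mem_univ, true_and, Fintype.mem_piFinset]
    refine forall_congr' fun b => ?_
    by_cases hb : b ∈ A <;> simp [hb]
  rw [this, Fintype.card_piFinset]
  have h2 : ∀ b, (if b ∈ A then ({y b} : Finset (ZMod 2)) else Finset.univ).card =
      if b ∈ A then 1 else 2 := by
    intro b; by_cases hb : b ∈ A <;> simp [hb, ZMod.card]
  simp only [h2]
  rw [Finset.prod_ite]
  simp only [Finset.prod_const_one, Finset.prod_const, one_mul]
  congr 1
  rw [Finset.filter_not, Finset.filter_mem_eq_inter, Finset.univ_inter,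
    Finset.card_sdiff_of_subset (Finset.subset_univ _)]
  simp

lemma prob_agree {s : ℕ} (A : Finset (Fin s)) (y : Source s) :
    prob (fun S : Source s => ∀ b ∈ A, S b = y b) = (1 / 2 : ℝ) ^ A.card := by
  classical
  unfold prob
  have h := card_filter_agree A y
  have hA : A.card ≤ s := by simpa using Finset.card_le_univ A
  have hc : Fintype.card (Source s) = 2 ^ s := by simp [Source, ZMod.card]
  have h' : (Finset.univ.filter (fun S : Source s => ∀ b ∈ A, S b = y b)).card * 2 ^ A.card
      = 2 ^ s := by
    rw [h, ← pow_add, Nat.sub_add_cancel hA]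
  rw [hc, one_div, inv_pow, div_eq_iff (by positivity), eq_comm, inv_mul_eq_iff_eq_mul₀
    (by positivity)]
  rw [mul_comm]
  have h'' := congrArg (Nat.cast : ℕ → ℝ) h'
  push_cast at h'' ⊢
  rw [← h'']
  congr!

/-- Conditional entropy of revealed bits given revealed bits. -/
lemma condEntropy_of_reveals {s : ℕ} {β γ : Type*} {X : Source s → β} {Z : Source s → γ}
    {A C : Finset (Fin s)} (hX : RevealsExactly X A) (hZ : RevealsExactly Z C) :
    condEntropy X Z = ((A \ C).card : ℝ) := by
  unfold condEntropy
  have key : ∀ S : Source s, -Real.logb 2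
      (prob (fun S' => X S' = X S ∧ Z S' = Z S) / prob (fun S' => Z S' = Z S)) =
      ((A \ C).card : ℝ) := by
    intro S
    have h1 : prob (fun S' => X S' = X S ∧ Z S' = Z S) = (1 / 2 : ℝ) ^ (A ∪ C).card := by
      rw [← prob_agree (A ∪ C) S]
      refine prob_congr fun S' => ?_
      rw [hX, hZ]
      simp only [Finset.mem_union, or_imp, forall_and]
    have h2 : prob (fun S' => Z S' = Z S) = (1 / 2 : ℝ) ^ C.card := by
      rw [← prob_agree C S]
      exact prob_congr fun S' => hZ _ _
    have h3 : (A ∪ C).card = (A \ C).card + C.card := by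
      rw [Finset.card_sdiff_add_card]
    rw [h1, h2, h3, pow_add, mul_div_assoc, div_self (by positivity), mul_one, one_div, inv_pow,
      Real.logb_inv, Real.logb_pow, Real.logb_self_eq_one (by norm_num)]
    simp
  simp only [key, Finset.sum_const, Finset.card_univ, nsmul_eq_mul]
  rw [mul_comm, mul_div_assoc, div_self (by exact_mod_cast Fintype.card_ne_zero), mul_one]

/-- Two realizations that agree on `C` can be glued along the disjoint sets `A` and `B`; after that
the identity of probabilities is inclusion–exclusion for exponents. -/
lemma condIndep_of_reveals {s : ℕ} {α β γ : Type*} {X : Source s → α} {Y : Source s → β}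
    {Z : Source s → γ} {A B C : Finset (Fin s)} (hX : RevealsExactly X A)
    (hY : RevealsExactly Y B) (hZ : RevealsExactly Z C) (hAB : Disjoint A B) :
    CondIndep X Y Z := by
  classical
  intro a b c
  by_cases ha : ∃ S, X S = a ∧ Z S = c
  swap
  · have ha' : ∀ S, ¬ (X S = a ∧ Z S = c) := fun S h => ha ⟨S, h⟩
    rw [prob_eq_zero ha', prob_eq_zero (fun S h => ha' S ⟨h.1, h.2.2⟩)]
    simp
  by_cases hb : ∃ S, Y S = b ∧ Z S = c
  swap
  · have hb' : ∀ S, ¬ (Y S = b ∧ Z S = c) := fun S h => hb ⟨S, h⟩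
    rw [prob_eq_zero hb', prob_eq_zero (fun S h => hb' S ⟨h.2.1, h.2.2⟩)]
    simp
  obtain ⟨S₁, rfl, h1⟩ := ha
  obtain ⟨S₂, rfl, rfl⟩ := hb
  have h12 := (hZ _ _).1 h1
  -- `S₁` and `S₂` agree on `C`, so this one realization takes all three prescribed values.
  let S₃ : Source s := fun t => if t ∈ A then S₁ t else S₂ t
  have e1 : ∀ t ∈ A, S₃ t = S₁ t := fun t ht => by simp [S₃, ht]
  have e2 : ∀ t ∈ B, S₃ t = S₂ t := fun t ht => by
    simp [S₃, Finset.disjoint_right.1 hAB ht]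
  have e3 : ∀ t ∈ C, S₃ t = S₂ t := fun t ht => by
    by_cases htA : t ∈ A
    · rw [e1 t htA, h12 t ht]
    · simp [S₃, htA]
  rw [← (hX _ _).2 e1, ← (hY _ _).2 e2, ← (hZ _ _).2 e3]
  have p1 : prob (fun S => X S = X S₃ ∧ Y S = Y S₃ ∧ Z S = Z S₃) =
      (1 / 2 : ℝ) ^ (A ∪ (B ∪ C)).card := by
    rw [← prob_agree _ S₃]
    refine prob_congr fun S => ?_
    rw [hX, hY, hZ]
    simp only [Finset.mem_union, or_imp, forall_and]
  have p2 : prob (fun S => Z S = Z S₃) = (1 / 2 : ℝ) ^ C.card := by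
    rw [← prob_agree _ S₃]
    exact prob_congr fun S => hZ _ _
  have p3 : prob (fun S => X S = X S₃ ∧ Z S = Z S₃) = (1 / 2 : ℝ) ^ (A ∪ C).card := by
    rw [← prob_agree _ S₃]
    refine prob_congr fun S => ?_
    rw [hX, hZ]
    simp only [Finset.mem_union, or_imp, forall_and]
  have p4 : prob (fun S => Y S = Y S₃ ∧ Z S = Z S₃) = (1 / 2 : ℝ) ^ (B ∪ C).card := by
    rw [← prob_agree _ S₃]
    refine prob_congr fun S => ?_
    rw [hY, hZ]
    simp only [Finset.mem_union, or_imp, forall_and]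
  rw [p1, p2, p3, p4, ← pow_add, ← pow_add]
  congr 1
  have h := Finset.card_union_add_card_inter (A ∪ C) (B ∪ C)
  have hu : (A ∪ C) ∪ (B ∪ C) = A ∪ (B ∪ C) := by
    ext t; simp only [Finset.mem_union]; tauto
  have hi : (A ∪ C) ∩ (B ∪ C) = C := by
    rw [← Finset.inter_union_distrib_right, Finset.disjoint_iff_inter_eq_empty.1 hAB,
      Finset.empty_union]
  rw [hu, hi] at h
  exact h

lemma mutuallyIndep_of_reveals {s : ℕ} {ι : Type*} [Fintype ι] [DecidableEq ι] {β : ι → Type*}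
    {X : ∀ i, Source s → β i} {a : Fin s → ι}
    (hX : ∀ i, RevealsExactly (X i) (Finset.univ.filter fun b => a b = i)) :
    MutuallyIndep X := by
  classical
  intro x
  by_cases hx : ∀ i, ∃ S, X i S = x i
  swap
  · push Not at hx
    obtain ⟨i, hi⟩ := hx
    rw [prob_eq_zero (fun S h => hi S (h i)),
      Finset.prod_eq_zero (Finset.mem_univ i) (prob_eq_zero hi)]
  choose T hT using hx
  -- Each bit is copied from the realization belonging to its own class, so all the prescribed
  -- values occur together.
  let S₀ : Source s := fun b => T (a b) b
  have h0 : ∀ i, X i S₀ = x i := fun i => by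
    rw [← hT i, hX i]
    intro b hb
    simp only [Finset.mem_filter, Finset.mem_univ, true_and] at hb
    simp [S₀, hb]
  have p1 : prob (fun S => ∀ i, X i S = x i) = (1 / 2 : ℝ) ^ (Finset.univ : Finset (Fin s)).card := by
    rw [← prob_agree _ S₀]
    refine prob_congr fun S => ?_
    simp only [← h0, hX _ _ _]
    simp only [Finset.mem_filter, Finset.mem_univ, true_and, true_imp_iff]
    exact ⟨fun h b => h _ b rfl, fun h _ b _ => h b⟩
  have p2 : ∀ i, prob (fun S => X i S = x i) =
      (1 / 2 : ℝ) ^ (Finset.univ.filter fun b => a b = i).card := fun i => by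
    rw [← prob_agree _ S₀]
    refine prob_congr fun S => ?_
    rw [← h0 i, hX i]
  simp only [p1, p2]
  rw [Finset.prod_pow_eq_pow_sum,
    ← Finset.card_eq_sum_card_fiberwise (fun b _ => Finset.mem_coe.2 (Finset.mem_univ (a b)))]

lemma reveals_bits {s : ℕ} (A : Finset (Fin s)) : RevealsExactly (bits A) A := by
  intro S S'
  constructor
  · intro h b hb
    exact congrFun h ⟨b, hb⟩
  · intro h
    funext b
    exact h b b.2

end IndexCoding

/-! ### The acyclic-set bound and scalar codes -/

namespace IndexCodingProblem

open IndexCoding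

variable {m s : ℕ} (P : IndexCodingProblem m s)

/-- If the bits of `B` can be ranked so that some decoder demands each bit of `B` and has only
lower-ranked bits of `B` as side information, then the correctly decoded source blocks are
determined by the codeword and the bits outside `B`. -/
lemma card_correct_le {n M : ℕ} (c : P.Code n M) (B : Finset (Fin s)) (ρ : Fin s → ℕ)
    (hρ : ∀ b ∈ B, ∃ α, b ∈ P.demand α ∧ ∀ b' ∈ B, b' ∈ P.side α → ρ b' < ρ b)
    (G : Finset (Fin n → Source s))
    (hG : ∀ S ∈ G, ∀ α, c.dec α (c.enc S) (fun t => bits (P.side α) (S t)) =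
      fun t => bits (P.demand α) (S t)) :
    G.card * 2 ^ (n * B.card) ≤ M * 2 ^ (n * s) := by
  classical
  have hB : B.card ≤ s := by simpa using Finset.card_le_univ B
  have hinj : Set.InjOn (fun S : Fin n → Source s =>
      ((c.enc S, fun t b => S t b) : Fin M × (Fin n → (Bᶜ : Finset (Fin s)) → ZMod 2))) G := by
    intro S hS S' hS' h
    simp only [Prod.mk.injEq] at h
    obtain ⟨henc, hout⟩ := h
    have hout' : ∀ t, ∀ b ∉ B, S t b = S' t b := fun t b hb =>
      congrFun (congrFun hout t) ⟨b, Finset.mem_compl.2 hb⟩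
    -- Decoding in order of rank: the side information of the decoder used for `b` lies outside `B`
    -- or has lower rank, so it is already determined.
    have key : ∀ r b, ρ b = r → ∀ t, S t b = S' t b := by
      intro r
      induction r using Nat.strong_induction_on with
      | _ r ih =>
        intro b hb t
        by_cases hbB : b ∈ B
        swap
        · exact hout' t b hbB
        obtain ⟨α, hα, hlow⟩ := hρ b hbB
        have hside : (fun t => bits (P.side α) (S t)) = fun t => bits (P.side α) (S' t) := by
          funext t b'
          by_cases hb' : b'.1 ∈ B
          · exact ih _ (hb ▸ hlow _ hb' b'.2) _ rfl t
          · exact hout' t _ hb'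
        have h1 := hG S hS α
        rw [henc, hside, hG S' hS' α] at h1
        exact (congrFun (congrFun h1 t) ⟨b, hα⟩).symm
    funext t b
    exact key _ b rfl t
  have hcard := Finset.card_le_card_of_injOn _
    (fun S _ => Finset.mem_coe.2 (Finset.mem_univ _)) hinj
  have hM : (Finset.univ : Finset (Fin M × (Fin n → (Bᶜ : Finset (Fin s)) → ZMod 2))).card =
      M * 2 ^ (n * (s - B.card)) := by
    simp [ZMod.card, ← pow_mul, mul_comm]
  rw [hM] at hcard
  calc G.card * 2 ^ (n * B.card) ≤ M * 2 ^ (n * (s - B.card)) * 2 ^ (n * B.card) :=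
        Nat.mul_le_mul_right _ hcard
    _ = M * 2 ^ (n * s) := by
        rw [mul_assoc, ← pow_add, ← mul_add, Nat.sub_add_cancel hB]

/-- The acyclic-set bound. -/
theorem card_le_of_achievable {R : ℝ} (hR : P.Achievable R) (B : Finset (Fin s)) (ρ : Fin s → ℕ)
    (hρ : ∀ b ∈ B, ∃ α, b ∈ P.demand α ∧ ∀ b' ∈ B, b' ∈ P.side α → ρ b' < ρ b) :
    (B.card : ℝ) ≤ R := by
  classical
  obtain ⟨M, c, hrate, herr⟩ := hR
  -- Error probability at most 1/2 suffices: discarding half of the blocks costs one bit in all,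
  -- that is, `1 / n` per symbol.
  have hlim : Tendsto (fun n : ℕ => R + 1 / (n : ℝ)) atTop (𝓝 (R + 0)) :=
    tendsto_const_nhds.add tendsto_one_div_atTop_nhds_zero_nat
  rw [add_zero] at hlim
  refine ge_of_tendsto hlim ?_
  filter_upwards [herr.eventually (eventually_le_nhds (show (0 : ℝ) < 1 / 2 by norm_num)),
    eventually_ge_atTop 1] with n hn hn1
  have hn0 : (0 : ℝ) < n := by exact_mod_cast hn1
  have hΩ : Fintype.card (Fin n → Source s) = 2 ^ (n * s) := by
    simp [Source, ZMod.card, ← pow_mul, mul_comm]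
  let E : (Fin n → Source s) → Prop := fun S => ∃ α,
    (c n).dec α ((c n).enc S) (fun t => bits (P.side α) (S t)) ≠ fun t => bits (P.demand α) (S t)
  have hE : ((Finset.univ.filter E).card : ℝ) / (2 : ℝ) ^ (n * s) ≤ 1 / 2 := by
    have h := hn
    unfold Code.errorProb prob at h
    rw [hΩ] at h
    push_cast at h
    refine le_of_eq_of_le ?_ h
    congr!
  rw [div_le_iff₀ (by positivity)] at hE
  have hsplit : ((Finset.univ.filter E).card : ℝ) + (Finset.univ.filter (fun S => ¬ E S)).card =
      (2 : ℝ) ^ (n * s) := by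
    have := Finset.card_filter_add_card_filter_not (s := Finset.univ) E
    rw [Finset.card_univ, hΩ] at this
    exact_mod_cast this
  have hG := P.card_correct_le (c n) B ρ hρ (Finset.univ.filter (fun S => ¬ E S)) (by
    intro S hS α
    simp only [Finset.mem_filter, Finset.mem_univ, true_and, E, not_exists, not_not] at hS
    exact hS α)
  have hG' : ((Finset.univ.filter (fun S => ¬ E S)).card : ℝ) * 2 ^ (n * B.card) ≤
      (M n : ℝ) * 2 ^ (n * s) := by exact_mod_cast hG
  have hpos : (0 : ℝ) < 2 ^ (n * s) := by positivity
  have hpos' : (0 : ℝ) < 2 ^ (n * B.card) := by positivity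
  have hM : (2 : ℝ) ^ (n * B.card) / 2 ≤ M n := by
    have h1 : (2 : ℝ) ^ (n * s) / 2 ≤ (Finset.univ.filter (fun S => ¬ E S)).card := by linarith
    have h2 := (mul_le_mul_of_nonneg_right h1 hpos'.le).trans hG'
    have h3 : (2 : ℝ) ^ (n * B.card) / 2 * 2 ^ (n * s) ≤ M n * 2 ^ (n * s) := by linarith
    exact le_of_mul_le_mul_right h3 hpos
  have hlog : (n * B.card : ℝ) - 1 ≤ Real.logb 2 (M n) := by
    have h := Real.logb_le_logb_of_le (b := 2) (by norm_num) (by positivity) hM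
    rw [Real.logb_div hpos'.ne' (by norm_num), Real.logb_pow,
      Real.logb_self_eq_one (by norm_num)] at h
    push_cast at h
    linarith
  have hr := hrate n hn1
  rw [div_le_iff₀ hn0] at hr
  have : (n : ℝ) * B.card ≤ (R + 1 / n) * n := by
    rw [add_mul, one_div, inv_mul_cancel₀ hn0.ne']; linarith
  rw [mul_comm] at this
  exact le_of_mul_le_mul_right this hn0

/-- A zero-error scalar code with `2 ^ r` codewords makes the rate `r` achievable. -/
theorem achievable_of_scalar {W : Type*} [Fintype W] {r : ℕ} (hW : Fintype.card W = 2 ^ r)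
    (e : Source s → W)
    (he : ∀ α S S', e S = e S' → (∀ b ∈ P.side α, S b = S' b) →
      ∀ b ∈ P.demand α, S b = S' b) :
    P.Achievable r := by
  classical
  have hcard : ∀ n : ℕ, Fintype.card (Fin n → W) = 2 ^ (r * n) := fun n => by
    simp [hW, ← pow_mul]
  let φ : ∀ n, (Fin n → W) ≃ Fin (2 ^ (r * n)) := fun n => Fintype.equivFinOfCardEq (hcard n)
  have hdec : ∀ α, ∃ g : W → (P.side α → ZMod 2) → (P.demand α → ZMod 2),
      ∀ S, g (e S) (bits (P.side α) S) = bits (P.demand α) S := by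
    intro α
    refine exists_factor fun S S' h1 h2 => ?_
    rw [reveals_bits] at h2 ⊢
    exact he α S S' h1 h2
  choose g hg using hdec
  refine ⟨fun n => 2 ^ (r * n), fun n =>
    ⟨fun S => φ n fun t => e (S t), fun α w y t => g α ((φ n).symm w t) (y t)⟩, ?_, ?_⟩
  · intro n hn
    have hn0 : (0 : ℝ) < n := by exact_mod_cast hn
    push_cast
    rw [Real.logb_pow, Real.logb_self_eq_one (by norm_num)]
    push_cast
    rw [mul_one, mul_div_assoc, div_self hn0.ne', mul_one]
  · refine tendsto_const_nhds.congr fun n => ?_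
    symm
    refine prob_eq_zero fun S => ?_
    rintro ⟨α, h⟩
    apply h
    funext t
    simp [hg]

end IndexCodingProblem

/-! ### Linear codes serving three decoders at once -/

namespace IndexCoding

/-- Two proper subspaces do not cover the space. -/
lemma exists_notMem_of_card_le_two {K V ι : Type*} [Field K] [AddCommGroup V] [Module K V]
    (J : Finset ι) (hJ : J.card ≤ 2) (W : ι → Submodule K V) (hW : ∀ i ∈ J, W i ≠ ⊤) :
    ∃ w, ∀ i ∈ J, w ∉ W i := by
  classical
  have hex : ∀ i ∈ J, ∃ w, w ∉ W i := fun i hi => by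
    by_contra h
    push Not at h
    exact hW i hi (Submodule.eq_top_iff'.2 h)
  have hc : J.card = 0 ∨ J.card = 1 ∨ J.card = 2 := by omega
  rcases hc with h | h | h
  · rw [Finset.card_eq_zero] at h
    exact ⟨0, by simp [h]⟩
  · obtain ⟨i, rfl⟩ := Finset.card_eq_one.1 h
    obtain ⟨w, hw⟩ := hex i (by simp)
    exact ⟨w, by simpa using hw⟩
  · obtain ⟨i, j, -, rfl⟩ := Finset.card_eq_two.1 h
    obtain ⟨x, hx⟩ := hex i (by simp)
    obtain ⟨y, hy⟩ := hex j (by simp)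
    simp only [Finset.mem_insert, Finset.mem_singleton, forall_eq_or_imp, forall_eq]
    by_cases hxj : x ∈ W j
    · by_cases hyi : y ∈ W i
      · refine ⟨x + y, fun h => hx ?_, fun h => hy ?_⟩
        · exact (Submodule.add_mem_iff_left _ hyi).1 h
        · exact (Submodule.add_mem_iff_right _ hxj).1 h
      · exact ⟨y, hyi, hy⟩
    · exact ⟨x, hx, hxj⟩

/-- For at most three sets of size at most `k`, there are vectors of length `k` that are linearly
independent on each of the sets. -/
theorem exists_linearIndepOn {K ι X : Type*} [Field K] [Fintype X] [DecidableEq X]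
    (I : Finset ι) (hI : I.card ≤ 3) (T : ι → Finset X) (k : ℕ) (hT : ∀ i ∈ I, (T i).card ≤ k) :
    ∃ v : X → (Fin k → K), ∀ i ∈ I, LinearIndepOn K v (T i : Set X) := by
  classical
  rcases I.eq_empty_or_nonempty with rfl | ⟨i₀, hi₀⟩
  · exact ⟨0, by simp⟩
  -- Elements common to all the sets get distinct unit vectors. Any other element lies in at most
  -- two of the sets, so its vector only has to avoid two subspaces.
  let D : Finset X := Finset.univ.filter fun x => ∀ i ∈ I, x ∈ T i
  have hD : ∀ x, x ∈ D ↔ ∀ i ∈ I, x ∈ T i := fun x => by simp [D]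
  have key : ∀ Z : Finset X, Disjoint Z D →
      ∃ v : X → (Fin k → K), ∀ i ∈ I, LinearIndepOn K v (T i ∩ (D ∪ Z) : Finset X) := by
    intro Z
    induction Z using Finset.induction_on with
    | empty =>
      intro _
      have hDk : Fintype.card D ≤ Fintype.card (Fin k) := by
        rw [Fintype.card_coe, Fintype.card_fin]
        exact (Finset.card_le_card fun x hx => (hD x).1 hx i₀ hi₀).trans (hT i₀ hi₀)
      obtain ⟨φ⟩ := Function.Embedding.nonempty_of_card_le hDk
      let v : X → (Fin k → K) := fun x => if h : x ∈ D then Pi.single (φ ⟨x, h⟩) 1 else 0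
      have hv : LinearIndepOn K v (D : Set X) := by
        have h1 := (Pi.basisFun K (Fin k)).linearIndependent.comp φ φ.injective
        refine (linearIndependent_equiv' (Equiv.refl _) ?_).1 h1
        funext x
        simp [v, Pi.basisFun_apply]
      refine ⟨v, fun i hi => hv.mono ?_⟩
      intro x hx
      simp only [Finset.union_empty, Finset.coe_inter, Set.mem_inter_iff] at hx
      exact hx.2
    | insert x Z hxZ ih =>
      intro hdisj
      rw [Finset.disjoint_insert_left] at hdisj
      obtain ⟨v, hv⟩ := ih hdisj.2
      let J := I.filter fun i => x ∈ T i
      have hJ : J.card ≤ 2 := by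
        have : J ⊂ I := by
          refine Finset.filter_ssubset.2 ?_
          by_contra h
          push Not at h
          exact hdisj.1 ((hD x).2 h)
        have := Finset.card_lt_card this
        omega
      -- The spans are proper: the part of `T i` treated so far omits `x`, so it has fewer than `k`
      -- elements.
      obtain ⟨w, hw⟩ := exists_notMem_of_card_le_two J hJ
        (fun i => Submodule.span K (v '' (T i ∩ (D ∪ Z) : Finset X))) (by
          intro i hi htop
          simp only [J, Finset.mem_filter] at hi
          have h1 : Module.finrank K (Submodule.span K (v '' (T i ∩ (D ∪ Z) : Finset X))) ≤
              (T i ∩ (D ∪ Z)).card := by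
            rw [← Finset.coe_image]
            exact (finrank_span_finset_le_card _).trans Finset.card_image_le
          rw [htop, finrank_top, Module.finrank_fin_fun] at h1
          have h2 : (T i ∩ (D ∪ Z)).card < (T i).card := by
            refine Finset.card_lt_card ⟨Finset.inter_subset_left, fun h => ?_⟩
            have := Finset.mem_inter.1 (h hi.2)
            rcases Finset.mem_union.1 this.2 with h' | h'
            · exact hdisj.1 h'
            · exact hxZ h'
          have := hT i hi.1
          omega)
      refine ⟨Function.update v x w, fun i hi => ?_⟩
      have hx : x ∉ T i ∩ (D ∪ Z) := by
        simp only [Finset.mem_inter, Finset.mem_union, not_and, not_or]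
        exact fun _ => ⟨hdisj.1, hxZ⟩
      have heq : Set.EqOn v (Function.update v x w) (T i ∩ (D ∪ Z) : Finset X) := by
        intro y hy
        have : y ≠ x := fun h => hx (h ▸ hy)
        simp [this]
      have hold := (hv i hi).congr heq
      by_cases hxT : x ∈ T i
      · have hins : T i ∩ (D ∪ insert x Z) = insert x (T i ∩ (D ∪ Z)) := by
          rw [Finset.union_insert, Finset.inter_insert_of_mem hxT]
        rw [hins, Finset.coe_insert]
        refine hold.insert ?_
        rw [← heq.image_eq, Function.update_self]
        exact hw i (Finset.mem_filter.2 ⟨hi, hxT⟩)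
      · have hins : T i ∩ (D ∪ insert x Z) = T i ∩ (D ∪ Z) := by
          rw [Finset.union_insert, Finset.inter_insert_of_notMem hxT]
        rw [hins]
        exact hold
  obtain ⟨v, hv⟩ := key Dᶜ disjoint_compl_left
  refine ⟨v, fun i hi => ?_⟩
  have := hv i hi
  rwa [Finset.union_compl, Finset.inter_univ] at this

end IndexCoding

namespace IndexCodingProblem

open IndexCoding

variable {m s : ℕ} (P : IndexCodingProblem m s)

/-- With at most three decoders, an allocation of each bit to a message received by all its
demanders achieves the sum over the messages of the largest number of missing bits. -/
theorem achievable_of_allocation (hm : m ≤ 3) (a : Fin s → Finset (Fin m))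
    (ha : ∀ α, ∀ b ∈ P.demand α, α ∈ a b) :
    P.Achievable ((∑ I : Finset (Fin m), I.sup fun i => (content a I \ P.side i).card : ℕ) : ℝ) := by
  classical
  have hv : ∀ I : Finset (Fin m), ∃ v : Fin s →
      (Fin (I.sup fun i => (content a I \ P.side i).card) → ZMod 2),
      ∀ i ∈ I, LinearIndepOn (ZMod 2) v (content a I \ P.side i : Finset (Fin s)) := by
    intro I
    have hI : I.card ≤ 3 := (by simpa using Finset.card_le_univ I : I.card ≤ m).trans hm
    exact exists_linearIndepOn I hI (fun i => content a I \ P.side i) _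
      (fun i hi => Finset.le_sup (f := fun i => (content a I \ P.side i).card) hi)
  choose v hv using hv
  refine P.achievable_of_scalar
    (W := ∀ I : Finset (Fin m), Fin (I.sup fun i => (content a I \ P.side i).card) → ZMod 2)
    (by simp [ZMod.card, Finset.prod_pow_eq_pow_sum])
    (fun S I => ∑ b ∈ content a I, S b • v I b) ?_
  intro α S S' he hs b hb
  have hI := ha α b hb
  -- Known bits cancel in the difference, which leaves a vanishing combination of the independent
  -- vectors of the bits that `α` misses.
  have hlin := linearIndepOn_finset_iff.1 (hv (a b) α hI) (fun b => S b - S' b) (by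
    have h1 : ∑ t ∈ content a (a b), (S t - S' t) • v (a b) t = 0 := by
      simp only [sub_smul, Finset.sum_sub_distrib]
      exact sub_eq_zero.2 (congrFun he (a b))
    rw [← h1]
    refine Finset.sum_subset Finset.sdiff_subset fun t ht ht' => ?_
    have hts : t ∈ P.side α := by
      by_contra h
      exact ht' (Finset.mem_sdiff.2 ⟨ht, h⟩)
    rw [hs t hts, sub_self, zero_smul])
  refine sub_eq_zero.1 (hlin b (Finset.mem_sdiff.2 ⟨?_, ?_⟩))
  · simp [content]
  · exact Finset.disjoint_left.1 (P.demand_disjoint_side α) hb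

end IndexCodingProblem

/-! ### The allocation produced by CAPM -/

namespace IndexCoding

lemma exists_terminal {α : Type*} {r : α → α → Prop} (μ : α → ℕ)
    (h : ∀ a a', r a a' → μ a' < μ a) (a : α) :
    ∃ a', Relation.ReflTransGen r a a' ∧ ∀ a'', ¬ r a' a'' := by
  induction hn : μ a using Nat.strong_induction_on generalizing a with
  | _ n ih =>
    by_cases hr : ∃ a', r a a'
    · obtain ⟨a', ha'⟩ := hr
      obtain ⟨a'', h1, h2⟩ := ih _ (hn ▸ h a a' ha') a' rfl
      exact ⟨a'', .head ha' h1, h2⟩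
    · exact ⟨a, .refl, fun a' h => hr ⟨a', h⟩⟩

lemma exists_isLeast_fin {n : ℕ} {A : Set (Fin n)} (hA : A.Nonempty) : ∃ i, IsLeast A i := by
  classical
  have hne : A.toFinset.Nonempty := by simpa using hA
  refine ⟨A.toFinset.min' hne, ?_⟩
  have := Finset.isLeast_min' _ hne
  simpa using this

lemma eq_or_eq_or_eq_of_le_three {m : ℕ} (hm : m ≤ 3) {i j k : Fin m} (hij : i ≠ j) (hik : i ≠ k)
    (hjk : j ≠ k) (l : Fin m) : l = i ∨ l = j ∨ l = k := by
  simp only [Fin.ext_iff, ne_eq] at *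
  omega

end IndexCoding

namespace IndexCodingProblem

open IndexCoding

variable {m s : ℕ} (P : IndexCodingProblem m s)

lemma mem_content {a : Fin s → Finset (Fin m)} {I : Finset (Fin m)} {b : Fin s} :
    b ∈ content a I ↔ a b = I := by simp [content]

lemma need_eq (a : Fin s → Finset (Fin m)) (I : Finset (Fin m)) (i : Fin m) :
    P.need a I i = ((content a I \ P.side i).card : ℝ) :=
  condEntropy_of_reveals (reveals_bits _) (reveals_bits _)

lemma mem_step1_of_mem_demand {b : Fin s} {α : Fin m} (h : b ∈ P.demand α) : α ∈ P.step1 b := by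
  unfold step1
  split_ifs
  · simp
  · simp [demanders, h]

lemma notMem_side_of_mem_demand {b : Fin s} {α : Fin m} (h : b ∈ P.demand α) : b ∉ P.side α :=
  Finset.disjoint_left.1 (P.demand_disjoint_side α) h

/-- A bit outside the message of top level is demanded by one decoder, known to a second one and
of no concern to the third. -/
lemma step1_cases (hm : m ≤ 3) {b : Fin s} (h : P.step1 b ≠ Finset.univ) :
    ∃ d c x : Fin m, d ≠ c ∧ d ≠ x ∧ c ≠ x ∧ (∀ α, b ∈ P.demand α ↔ α = d) ∧
      (∀ α, b ∈ P.side α ↔ α = c) ∧ (∀ α, α ∈ P.step1 b ↔ α ≠ x) ∧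
      ∀ α, α = d ∨ α = c ∨ α = x := by
  have hmis : P.missing b ≠ Finset.univ := fun h' => h (by simp [step1, h'])
  have hstep : ∀ α, α ∈ P.step1 b ↔ b ∈ P.demand α ∨ b ∈ P.side α := fun α => by
    rw [step1, if_neg hmis]
    simp [demanders, missing]
  obtain ⟨d, hd⟩ := P.demanded b
  obtain ⟨c, hc⟩ : ∃ c, b ∈ P.side c := by
    by_contra hcon
    push Not at hcon
    exact hmis (Finset.eq_univ_iff_forall.2 fun α => by simp [missing, hcon α])
  obtain ⟨x, hx⟩ : ∃ x, x ∉ P.step1 b := by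
    by_contra hcon
    push Not at hcon
    exact h (Finset.eq_univ_iff_forall.2 hcon)
  have hx' := hx
  rw [hstep, not_or] at hx'
  have hdc : d ≠ c := by rintro rfl; exact P.notMem_side_of_mem_demand hd hc
  have hdx : d ≠ x := by rintro rfl; exact hx'.1 hd
  have hcx : c ≠ x := by rintro rfl; exact hx'.2 hc
  have hcov := eq_or_eq_or_eq_of_le_three hm hdc hdx hcx
  refine ⟨d, c, x, hdc, hdx, hcx, ?_, ?_, ?_, hcov⟩
  · intro α
    refine ⟨fun h => ?_, fun h => h ▸ hd⟩
    rcases hcov α with rfl | rfl | rfl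
    · rfl
    · exact absurd hc (P.notMem_side_of_mem_demand h)
    · exact absurd h hx'.1
  · intro α
    refine ⟨fun h => ?_, fun h => h ▸ hc⟩
    rcases hcov α with rfl | rfl | rfl
    · exact absurd h (P.notMem_side_of_mem_demand hd)
    · rfl
    · exact absurd h hx'.2
  · intro α
    refine ⟨fun h h' => hx (h' ▸ h), fun h => ?_⟩
    rcases hcov α with rfl | rfl | rfl
    · exact (hstep _).2 (.inl hd)
    · exact (hstep _).2 (.inr hc)
    · exact absurd rfl h

/-- All decoders of `I` miss the same number of bits of `U_I`. -/
def Balanced (a : Fin s → Finset (Fin m)) (I : Finset (Fin m)) : Prop :=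
  ∀ i ∈ I, ∀ j ∈ I, (content a I \ P.side i).card = (content a I \ P.side j).card

/-- The invariant of Step 2: excess bits are in the message of top level; those from one message
have the same demander, who misses the most bits of that message. -/
structure ExcessInvariant (a : Fin s → Finset (Fin m)) : Prop where
  eq_or_eq : ∀ b, a b = P.step1 b ∨ a b = Finset.univ
  demand_eq : ∀ b b', a b ≠ P.step1 b → a b' ≠ P.step1 b' → P.step1 b = P.step1 b' →
    ∀ d, b ∈ P.demand d → b' ∈ P.demand d
  card_le : ∀ b, a b ≠ P.step1 b → ∀ d, b ∈ P.demand d → ∀ l ∈ P.step1 b,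
    (content a (P.step1 b) \ P.side l).card ≤ (content a (P.step1 b) \ P.side d).card

lemma excessInvariant_step1 : P.ExcessInvariant P.step1 :=
  ⟨fun _ => .inl rfl, fun _ _ h => absurd rfl h, fun _ h => absurd rfl h⟩

lemma content_update_self {a : Fin s → Finset (Fin m)} {I J : Finset (Fin m)} {b : Fin s}
    (hJ : J ≠ I) : content (Function.update a b J) I = (content a I).erase b := by
  ext t
  rw [mem_content, Finset.mem_erase, mem_content]
  by_cases ht : t = b
  · subst ht; simp [hJ]
  · simp [ht]

lemma content_update_of_ne {a : Fin s → Finset (Fin m)} {I J : Finset (Fin m)} {b : Fin s}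
    (hJ : J ≠ I) (hb : a b ≠ I) : content (Function.update a b J) I = content a I := by
  rw [content_update_self hJ, Finset.erase_eq_of_notMem (by rwa [mem_content])]

variable {P}

lemma IsNext.exists_eq_insert {a : Fin s → Finset (Fin m)} {I J : Finset (Fin m)}
    (h : IsNext a I J) : ∃ j ∉ I, J = insert j I := by
  obtain ⟨j, rfl, h | h⟩ := h
  · exact ⟨j, h.1.1, rfl⟩
  · exact ⟨j, h.2.1, rfl⟩

lemma IsNext.ne {a : Fin s → Finset (Fin m)} {I J : Finset (Fin m)} (h : IsNext a I J) :
    J ≠ I := by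
  obtain ⟨j, hj, rfl⟩ := h.exists_eq_insert
  exact fun h => hj (h ▸ Finset.mem_insert_self j I)

lemma Move.card_content_lt {I : Finset (Fin m)} {a a' : Fin s → Finset (Fin m)}
    (h : P.Move I a a') : (content a' I).card < (content a I).card := by
  obtain ⟨i, j, b, J, -, -, -, hb, hJ, rfl⟩ := h
  rw [content_update_self hJ.ne]
  exact Finset.card_erase_lt_of_mem hb.1.1

/-- The message is `{d, c}` for the demander `d` and the only knower `c` of the moved bit. Being
known to `i*` and not to `j*` forces `i* = c` and `j* = d`, and the only index outside the message
is the third decoder, so the next level is the top. -/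
lemma Move.exists_excess (hm : m ≤ 3) {I : Finset (Fin m)} {a a' : Fin s → Finset (Fin m)}
    (ha : P.ExcessInvariant a) (h : P.Move I a a') :
    I ≠ Finset.univ ∧ ∃ (b : Fin s) (d c : Fin m), a' = Function.update a b Finset.univ ∧ a b = I ∧
      P.step1 b = I ∧ (∀ α, b ∈ P.demand α ↔ α = d) ∧ b ∈ P.side c ∧ b ∉ P.side d ∧
      (∀ α, α ∈ I ↔ α = d ∨ α = c) ∧
      (content a I \ P.side c).card < (content a I \ P.side d).card := by
  obtain ⟨i, j, b, J, hi, hj, hlt, hb, hJ, rfl⟩ := h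
  obtain ⟨y, hy, rfl⟩ := hJ.exists_eq_insert
  have hI : I ≠ Finset.univ := fun h => hy (h ▸ Finset.mem_univ y)
  have hab : a b = I := mem_content.1 hb.1.1
  have hs1 : P.step1 b = I := by
    rcases ha.eq_or_eq b with h | h
    · rw [← h, hab]
    · exact absurd (hab.symm.trans h) hI
  obtain ⟨d, c, x, hdc, hdx, hcx, hdem, hside, hst, hcov⟩ := P.step1_cases hm (hs1.symm ▸ hI)
  rw [hs1] at hst
  have hic : i = c := (hside i).1 hb.1.2.1
  have hjd : j = d := by
    rcases hcov j with h | h | h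
    · exact h
    · exact absurd ((hside j).2 h) hb.1.2.2
    · exact absurd h ((hst j).1 hj.1.1)
  have hyx : y = x := by
    by_contra h
    exact hy ((hst y).2 h)
  have huniv : insert y I = Finset.univ := by
    refine Finset.eq_univ_iff_forall.2 fun α => ?_
    by_cases h : α = x
    · rw [h, ← hyx]; exact Finset.mem_insert_self _ _
    · exact Finset.mem_insert_of_mem ((hst α).2 h)
  subst hic hjd
  rw [P.need_eq, P.need_eq] at hlt
  refine ⟨hI, b, j, i, by rw [huniv], hab, hs1, hdem, hb.1.2.1, hb.1.2.2, fun α => ?_,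
    by exact_mod_cast hlt⟩
  rw [hst]
  constructor
  · intro h
    rcases hcov α with h' | h' | h'
    · exact .inl h'
    · exact .inr h'
    · exact absurd h' h
  · rintro (rfl | rfl)
    · exact hdx
    · exact hcx

lemma Move.content_eq (hm : m ≤ 3) {I I' : Finset (Fin m)} {a a' : Fin s → Finset (Fin m)}
    (ha : P.ExcessInvariant a) (h : P.Move I a a') (hI' : I' ≠ Finset.univ) (hne : I' ≠ I) :
    content a' I' = content a I' := by
  obtain ⟨-, b, d, c, rfl, hab, -⟩ := h.exists_excess hm ha
  exact content_update_of_ne hI'.symm (hab ▸ hne.symm)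

/-- Had an earlier excess bit of this message been demanded by `c`, then `c` would miss at least as
many bits as `d`, contrary to the strict inequality that triggers the move. -/
lemma Move.excessInvariant (hm : m ≤ 3) {I : Finset (Fin m)} {a a' : Fin s → Finset (Fin m)}
    (ha : P.ExcessInvariant a) (h : P.Move I a a') : P.ExcessInvariant a' := by
  have hcont := fun I' => h.content_eq hm ha (I' := I')
  obtain ⟨hI, b, d, c, rfl, hab, hs1, hdem, hbc, hbd, hmem, hlt⟩ := h.exists_excess hm ha
  have hself := content_update_self (a := a) (b := b) hI.symm
  have hold : ∀ b', b' ≠ b → Function.update a b Finset.univ b' ≠ P.step1 b' →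
      a b' ≠ P.step1 b' := fun b' hb' h => by rwa [Function.update_of_ne hb'] at h
  have hdemand : ∀ b', P.step1 b' = I → Function.update a b Finset.univ b' ≠ P.step1 b' →
      ∀ e, b' ∈ P.demand e ↔ e = d := by
    intro b' hb'I hb'
    by_cases hbb : b' = b
    · rw [hbb]; exact hdem
    have hcl := ha.card_le b' (hold b' hbb hb')
    have honly : ∀ e, b' ∈ P.demand e → e = d := by
      intro e he
      rcases (hmem e).1 (hb'I ▸ P.mem_step1_of_mem_demand he) with h' | rfl
      · exact h'
      · have := hcl e he d (hb'I.symm ▸ (hmem d).2 (.inl rfl))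
        rw [hb'I] at this
        omega
    obtain ⟨e, he⟩ := P.demanded b'
    exact fun e' => ⟨honly e', fun h' => by rw [h', ← honly e he]; exact he⟩
  refine ⟨fun b' => ?_, fun b₁ b₂ h1 h2 h12 e he => ?_, fun b₁ h1 e he l hl => ?_⟩
  · by_cases hbb : b' = b
    · right; simp [hbb]
    · rw [Function.update_of_ne hbb]; exact ha.eq_or_eq b'
  · by_cases hI1 : P.step1 b₁ = I
    · rw [hdemand b₂ (h12 ▸ hI1) h2, ← hdemand b₁ hI1 h1]
      exact he
    · exact ha.demand_eq b₁ b₂ (hold _ (by rintro rfl; exact hI1 hs1) h1)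
        (hold _ (by rintro rfl; exact hI1 (h12.trans hs1)) h2) h12 e he
  · by_cases hI1 : P.step1 b₁ = I
    · rw [(hdemand b₁ hI1 h1 e).1 he]
      rw [hI1] at hl ⊢
      rcases (hmem l).1 hl with rfl | rfl
      · exact le_rfl
      · rw [hself, Finset.erase_sdiff_comm, Finset.erase_sdiff_comm]
        -- The count of `d` drops by exactly one and the other does not grow, so the strict
        -- inequality weakens to `≤`.
        have h3 := Finset.card_erase_le (s := content a I \ P.side l) (a := b)
        have h4 := Finset.card_erase_of_mem (s := content a I \ P.side d) (a := b)
          (Finset.mem_sdiff.2 ⟨mem_content.2 hab, hbd⟩)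
        omega
    · have h1' := hold _ (by rintro rfl; exact hI1 hs1) h1
      have hu : P.step1 b₁ ≠ Finset.univ := fun hu => by
        rcases ha.eq_or_eq b₁ with h' | h'
        · exact h1' h'
        · exact h1' (h'.trans hu.symm)
      rw [hcont _ hu hI1]
      exact ha.card_le b₁ h1' e he l hl

lemma exists_move_of_not_balanced {I : Finset (Fin m)} {a : Fin s → Finset (Fin m)}
    (hI : I ≠ Finset.univ) (h : ¬ P.Balanced a I) : ∃ a', P.Move I a a' := by
  classical
  unfold Balanced at h
  push Not at h
  obtain ⟨p, hp, q, hq, hpq⟩ := h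
  obtain ⟨i, hi⟩ := exists_isLeast_fin (A := {k | k ∈ I ∧ ∀ l ∈ I, P.need a I k ≤ P.need a I l})
    (Finset.exists_min_image I _ ⟨p, hp⟩)
  obtain ⟨j, hj⟩ := exists_isLeast_fin (A := {k | k ∈ I ∧ ∀ l ∈ I, P.need a I l ≤ P.need a I k})
    (Finset.exists_max_image I _ ⟨p, hp⟩)
  have hlt : P.need a I i < P.need a I j := by
    have hpq' : P.need a I p ≠ P.need a I q := by
      rw [need_eq, need_eq]; exact_mod_cast hpq
    rcases lt_or_gt_of_ne hpq' with h | h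
    · exact (hi.1.2 p hp).trans_lt (h.trans_le (hj.1.2 q hq))
    · exact (hi.1.2 q hq).trans_lt (h.trans_le (hj.1.2 p hp))
  have hlt' : (content a I \ P.side i).card < (content a I \ P.side j).card := by
    rw [need_eq, need_eq] at hlt; exact_mod_cast hlt
  -- Since `j` misses more bits of the message than `i`, it misses one that `i` knows, so there is a
  -- bit to move.
  obtain ⟨t, ht1, ht2⟩ := Finset.exists_mem_notMem_of_card_lt_card hlt'
  rw [Finset.mem_sdiff] at ht1 ht2
  obtain ⟨b, hb⟩ := exists_isLeast_fin
    (A := {b | b ∈ content a I ∧ b ∈ P.side i ∧ b ∉ P.side j})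
    ⟨t, ht1.1, by_contra fun h => ht2 ⟨ht1.1, h⟩, ht1.2⟩
  have hnext : ∃ J, IsNext a I J := by
    by_cases hk : ∃ k, k ∉ I ∧ (content a (insert k I)).Nonempty
    · obtain ⟨k, hk'⟩ := exists_isLeast_fin
        (A := {k | k ∉ I ∧ (content a (insert k I)).Nonempty}) hk
      exact ⟨_, k, rfl, .inl hk'⟩
    · obtain ⟨k, hk'⟩ := exists_isLeast_fin (A := {k | k ∉ I}) (by
        by_contra hcon
        rw [Set.not_nonempty_iff_eq_empty] at hcon
        exact hI (Finset.eq_univ_iff_forall.2 fun k => by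
          by_contra hk
          exact (hcon ▸ hk : k ∈ (∅ : Set (Fin m)))))
      exact ⟨_, k, rfl, .inr ⟨hk, hk'⟩⟩
  obtain ⟨J, hJ⟩ := hnext
  exact ⟨_, i, j, b, J, hi, hj, hlt, hb, hJ, rfl⟩

lemma Settle.spec (hm : m ≤ 3) {I : Finset (Fin m)} {a a' : Fin s → Finset (Fin m)}
    (hI : I ≠ Finset.univ) (ha : P.ExcessInvariant a) (h : P.Settle I a a') :
    P.ExcessInvariant a' ∧ P.Balanced a' I ∧
      ∀ I', I' ≠ Finset.univ → I' ≠ I → content a' I' = content a I' := by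
  obtain ⟨hr, hterm⟩ := h
  have hind : P.ExcessInvariant a' ∧
      ∀ I', I' ≠ Finset.univ → I' ≠ I → content a' I' = content a I' := by
    clear hterm
    induction hr with
    | refl => exact ⟨ha, fun _ _ _ => rfl⟩
    | tail _ hmove ih =>
      exact ⟨hmove.excessInvariant hm ih.1, fun I' h1 h2 =>
        (hmove.content_eq hm ih.1 h1 h2).trans (ih.2 I' h1 h2)⟩
  refine ⟨hind.1, ?_, hind.2⟩
  by_contra hb
  obtain ⟨a'', h⟩ := exists_move_of_not_balanced hI hb
  exact hterm a'' h

lemma Balanced.congr {I : Finset (Fin m)} {a a' : Fin s → Finset (Fin m)}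
    (h : P.Balanced a I) (hc : content a' I = content a I) : P.Balanced a' I := by
  unfold Balanced
  rw [hc]
  exact h

/-- Processing one message changes no other message below the top, so balance once reached persists
and the order of the list does not matter. -/
lemma Step2.spec (hm : m ≤ 3) {L : List (Finset (Fin m))} {a a' : Fin s → Finset (Fin m)}
    (hL : L.Nodup) (hLu : ∀ I ∈ L, I ≠ Finset.univ) (ha : P.ExcessInvariant a)
    (h : P.Step2 L a a') :
    P.ExcessInvariant a' ∧ (∀ I ∈ L, P.Balanced a' I) ∧
      ∀ I, I ≠ Finset.univ → I ∉ L → content a' I = content a I := by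
  induction L generalizing a with
  | nil =>
    obtain rfl : a' = a := h
    exact ⟨ha, by simp, fun _ _ _ => rfl⟩
  | cons I L ih =>
    obtain ⟨a₁, h1, h2⟩ := h
    obtain ⟨hinv, hbal, hcont⟩ := h1.spec hm (hLu I (by simp)) ha
    rw [List.nodup_cons] at hL
    obtain ⟨hinv', hbal', hcont'⟩ := ih hL.2 (fun I' h' => hLu I' (by simp [h'])) hinv h2
    refine ⟨hinv', fun I' hI' => ?_, fun I' hu hI' => ?_⟩
    · rcases List.mem_cons.1 hI' with rfl | h'
      · exact hbal.congr (hcont' I' (hLu I' (by simp)) hL.1)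
      · exact hbal' I' h'
    · rw [List.mem_cons, not_or] at hI'
      exact (hcont' I' hu hI'.2).trans (hcont I' hu hI'.1)

/-- With at most three decoders, no two components can be added in Step 3. -/
lemma ExcessInvariant.not_xorStep {a : Fin s → Finset (Fin m)} (ha : P.ExcessInvariant a)
    {A : Finset (Fin s)} {C : Finset (Finset (Fin s))} :
    ¬ P.XorStep a (A.image fun b => {b}) C := by
  rintro ⟨V, hV, W, hW, -, hex, ⟨O, hO⟩, hVW, -, -⟩
  simp only [Finset.mem_image] at hV hW
  obtain ⟨b, -, rfl⟩ := hV
  obtain ⟨b', -, rfl⟩ := hW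
  obtain ⟨d, hd⟩ := P.demanded b
  -- Both bits are demanded by `d`, whereas the exclusive-OR would require `d` to know the second.
  have h1 := ha.demand_eq b b' (hex b (by simp)) (hex b' (by simp))
    ((hO b (by simp)).trans (hO b' (by simp)).symm) d hd
  have h2 : d ∈ P.havers {b'} := hVW (by simp [needers, hd])
  simp only [havers, Finset.mem_filter, Finset.mem_univ, true_and, Finset.mem_singleton,
    forall_eq] at h2
  exact P.notMem_side_of_mem_demand h1 h2

theorem IsCAPMOutput.spec (hm : m ≤ 3) {U : AuxChoice m s} (h : P.IsCAPMOutput U) :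
    ∃ a : Fin s → Finset (Fin m), P.ExcessInvariant a ∧
      (∀ I, I ≠ Finset.univ → P.Balanced a I) ∧ ∀ I, U I = (content a I).image fun b => {b} := by
  obtain ⟨L, a, hL, h2, h3⟩ := h
  obtain ⟨hinv, hbal, -⟩ := h2.spec hm hL.1 (fun I hI => (hL.2.1 I).1 hI) P.excessInvariant_step1
  refine ⟨a, hinv, fun I hI => hbal I ((hL.2.1 I).2 hI), fun I => ?_⟩
  rcases (h3 I).1.cases_head with h | ⟨C, hC, -⟩
  · exact h.symm
  · exact absurd hC hinv.not_xorStep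

/-! ### Existence of a CAPM output -/

variable (P)

lemma XorStep.card_lt {a : Fin s → Finset (Fin m)} {C C' : Finset (Finset (Fin s))}
    (h : P.XorStep a C C') : C'.card < C.card := by
  obtain ⟨V, hV, W, hW, hVW, -, -, -, -, rfl⟩ := h
  have h1 := Finset.card_erase_of_mem (Finset.mem_erase.2 ⟨hVW.symm, hW⟩)
  have h2 := Finset.card_erase_of_mem hV
  have h3 := Finset.card_insert_le (V ∪ W) ((C.erase V).erase W)
  have h4 := Finset.card_pos.2 ⟨W, Finset.mem_erase.2 ⟨hVW.symm, hW⟩⟩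
  omega

lemma exists_step2 (L : List (Finset (Fin m))) (a : Fin s → Finset (Fin m)) :
    ∃ a', P.Step2 L a a' := by
  induction L generalizing a with
  | nil => exact ⟨a, rfl⟩
  | cons I L ih =>
    obtain ⟨a₁, h1⟩ := exists_terminal (fun a => (content a I).card)
      (fun _ _ h => Move.card_content_lt (P := P) h) a
    obtain ⟨a', h'⟩ := ih a₁
    exact ⟨a', a₁, h1, h'⟩

lemma exists_isOrder (m : ℕ) : ∃ L : List (Finset (Fin m)), IsOrder L := by
  classical
  let r : Finset (Fin m) → Finset (Fin m) → Prop := fun I J => I.card ≤ J.card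
  have : Std.Total r := ⟨fun I J => le_total I.card J.card⟩
  have : IsTrans _ r := ⟨fun _ _ _ h1 h2 => le_trans h1 h2⟩
  have hperm := List.perm_insertionSort r (Finset.univ.erase Finset.univ).toList
  refine ⟨List.insertionSort r (Finset.univ.erase Finset.univ).toList, ?_, fun I => ?_,
    List.pairwise_insertionSort r _⟩
  · exact hperm.nodup_iff.2 (Finset.nodup_toList _)
  · rw [hperm.mem_iff]; simp

/-- Every move shrinks the message being processed and every exclusive-OR lowers the number of
components, so both steps terminate; this needs no bound on the number of decoders. -/
theorem exists_isCAPMOutput : ∃ U : AuxChoice m s, P.IsCAPMOutput U := by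
  obtain ⟨L, hL⟩ := exists_isOrder m
  obtain ⟨a, ha⟩ := P.exists_step2 L P.step1
  choose U hU using fun I : Finset (Fin m) => exists_terminal (r := P.XorStep a) Finset.card
    (fun _ _ h => XorStep.card_lt P h) ((content a I).image fun b => {b})
  exact ⟨U, L, a, hL, ha, hU⟩

/-! ### The rate formula -/

/-- The bits unknown to Decoder `i` among its demands and the reduced demands of the others. -/
def baseBits (i : Fin m) : Finset (Fin s) :=
  (P.demand i ∪ (Finset.univ.erase i).biUnion P.reducedDemand) \ P.side i

lemma rateAt_eq (i : Fin m) :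
    P.rateAt i = (((P.baseBits i).card +
      (Finset.univ.erase i).sup (fun j => (P.f {j} {i, j}).card) : ℕ) : ℝ) := by
  rw [rateAt, condEntropy_of_reveals (reveals_bits _) (reveals_bits _), Nat.cast_add]
  rfl

lemma mem_f_pair {i j : Fin m} {b : Fin s} : b ∈ P.f {j} {i, j} ↔
    (∀ α, b ∈ P.demand α ↔ α = j) ∧ ∀ α, b ∉ P.side α ↔ α = i ∨ α = j := by
  simp [f, demanders, missing, Finset.ext_iff]

lemma mem_baseBits {i : Fin m} {b : Fin s} : b ∈ P.baseBits i ↔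
    b ∉ P.side i ∧ (b ∈ P.demand i ∨ ∃ a, a ≠ i ∧ b ∈ P.demand a ∧
      ∀ β, β ≠ a → b ∉ P.f {a} {β, a}) := by
  simp only [baseBits, reducedDemand, Finset.mem_sdiff, Finset.mem_union, Finset.mem_biUnion,
    Finset.mem_erase, Finset.mem_univ, and_true, not_exists, not_and, Finset.pair_comm]
  tauto

/-- This lets the two terms of the rate at `i` be read as the size of one set. -/
lemma disjoint_baseBits_f {i j : Fin m} (hij : i ≠ j) :
    Disjoint (P.baseBits i) (P.f {j} {i, j}) := by
  rw [Finset.disjoint_left]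
  intro b hb hf
  have hf' := (P.mem_f_pair.1 hf).1
  rcases (P.mem_baseBits.1 hb).2 with h | ⟨a, -, h, hn⟩
  · exact hij ((hf' i).1 h)
  · obtain rfl := (hf' a).1 h
    exact hn i hij hf

theorem rateAt_le_of_achievable (hm : m ≤ 3) {R : ℝ} (hR : P.Achievable R) (i : Fin m) :
    P.rateAt i ≤ R := by
  classical
  rw [rateAt_eq]
  rcases (Finset.univ.erase i).eq_empty_or_nonempty with h | h
  · have hsub : ∀ α, α = i := fun α => by
      by_contra hα
      exact Finset.notMem_empty α (h ▸ Finset.mem_erase.2 ⟨hα, Finset.mem_univ α⟩)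
    rw [h, Finset.sup_empty, bot_eq_zero, add_zero]
    refine P.card_le_of_achievable hR _ (fun _ => 0) fun b _ => ?_
    obtain ⟨α, hα⟩ := P.demanded b
    refine ⟨α, hα, fun b' hb' hs => ?_⟩
    rw [hsub α] at hs
    exact absurd hs (P.mem_baseBits.1 hb').1
  obtain ⟨j, hj, hsup⟩ := Finset.exists_mem_eq_sup _ h (fun j => (P.f {j} {i, j}).card)
  have hij : i ≠ j := (Finset.ne_of_mem_erase hj).symm
  rw [hsup, ← Finset.card_union_of_disjoint (P.disjoint_baseBits_f hij)]
  have hside : ∀ b ∈ P.baseBits i ∪ P.f {j} {i, j}, b ∉ P.side i := fun b hb => by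
    rcases Finset.mem_union.1 hb with h | h
    · exact (P.mem_baseBits.1 h).1
    · exact ((P.mem_f_pair.1 h).2 i).2 (.inl rfl)
  -- Rank in the order of decoding: demands of `i`, then of `j`, then of the third decoder.
  refine P.card_le_of_achievable hR _
    (fun b => if b ∈ P.demand i then 0 else if b ∈ P.demand j then 1 else 2) fun b _ => ?_
  by_cases hbi : b ∈ P.demand i
  · exact ⟨i, hbi, fun b' hb' hs => absurd hs (hside b' hb')⟩
  by_cases hbj : b ∈ P.demand j
  · refine ⟨j, hbj, fun b' hb' hs => ?_⟩
    suffices b' ∈ P.demand i by simp [this, hbi, hbj]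
    rcases Finset.mem_union.1 hb' with h | h
    · rcases (P.mem_baseBits.1 h).2 with h | ⟨a, hai, had, hna⟩
      · exact h
      by_contra hni
      have haj : a ≠ j := by rintro rfl; exact P.notMem_side_of_mem_demand had hs
      have hcov := eq_or_eq_or_eq_of_le_three hm hij hai.symm haj.symm
      -- A bit known to `j` and not demanded by `i` would lie in `f {a} {i, a}`, which the reduced
      -- demand of `a` excludes.
      refine hna i hai.symm (P.mem_f_pair.2 ⟨fun α => ?_, fun α => ?_⟩)
      · refine ⟨fun hα => ?_, fun hα => hα ▸ had⟩
        rcases hcov α with rfl | rfl | rfl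
        · exact absurd hα hni
        · exact absurd hs (P.notMem_side_of_mem_demand hα)
        · rfl
      · refine ⟨fun hα => ?_, ?_⟩
        · rcases hcov α with h | rfl | h
          · exact .inl h
          · exact absurd hs hα
          · exact .inr h
        · rintro (rfl | rfl)
          · exact hside b' hb'
          · exact P.notMem_side_of_mem_demand had
    · exact absurd hs (((P.mem_f_pair.1 h).2 j).2 (.inr rfl))
  · obtain ⟨a, ha⟩ := P.demanded b
    refine ⟨a, ha, fun b' hb' hs => ?_⟩
    have hai : a ≠ i := by rintro rfl; exact hbi ha
    have haj : a ≠ j := by rintro rfl; exact hbj ha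
    -- What the third decoder knows it does not demand, so `i` or `j` demands it and its rank is
    -- lower.
    obtain ⟨e, he⟩ := P.demanded b'
    have hea : e ≠ a := by rintro rfl; exact P.notMem_side_of_mem_demand he hs
    rcases eq_or_eq_or_eq_of_le_three hm hij hai.symm haj.symm e with rfl | rfl | rfl
    · simp [he, hbi, hbj]
    · simp only [he, hbi, hbj, if_true, if_false]
      split_ifs <;> norm_num
    · exact absurd rfl hea

theorem maxRate_le_of_achievable (hm : m ≤ 3) {R : ℝ} (hR : P.Achievable R) : P.maxRate ≤ R := by
  -- Needed when there are no decoders: the supremum over the empty type is `0`.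
  have h0 : (0 : ℝ) ≤ R := by
    simpa using P.card_le_of_achievable hR ∅ (fun _ => 0) (by simp)
  exact Real.iSup_le (fun i => P.rateAt_le_of_achievable hm hR i) h0

lemma iSup_coe_eq_sup {ι : Type*} (I : Finset ι) (g : ι → ℕ) :
    (⨆ i : I, (g i : ℝ)) = ((I.sup g : ℕ) : ℝ) := by
  rcases I.eq_empty_or_nonempty with rfl | h
  · simp [Real.iSup_of_isEmpty]
  · have : Nonempty I := h.to_subtype
    refine le_antisymm (ciSup_le fun i => ?_) ?_
    · exact_mod_cast Finset.le_sup (f := g) i.2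
    · obtain ⟨i, hi, h⟩ := Finset.exists_mem_eq_sup I h g
      rw [h]
      exact le_ciSup (f := fun i : I => (g i : ℝ)) (Set.finite_range _).bddAbove ⟨i, hi⟩

/-! ### Messages consisting of source bits -/

lemma reveals_var {U : AuxChoice m s} {a : Fin s → Finset (Fin m)} {I : Finset (Fin m)}
    (h : U I = (content a I).image fun b => {b}) : RevealsExactly (U.var I) (content a I) := by
  intro S S'
  constructor
  · intro hS b hb
    have := congrFun hS ⟨{b}, by rw [h]; exact Finset.mem_image_of_mem _ hb⟩
    simpa [AuxChoice.var] using this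
  · intro hS
    funext ⟨V, hV⟩
    have hV' := hV
    rw [h, Finset.mem_image] at hV'
    obtain ⟨b, hb, rfl⟩ := hV'
    simpa [AuxChoice.var] using hS b hb

lemma reveals_jointVar {U : AuxChoice m s} {a : Fin s → Finset (Fin m)}
    (hU : ∀ I, U I = (content a I).image fun b => {b})
    (J : Finset (Finset (Fin m))) :
    RevealsExactly (jointVar U J) (Finset.univ.filter fun b => a b ∈ J) := by
  intro S S'
  simp only [Finset.mem_filter, Finset.mem_univ, true_and]
  constructor
  · intro h b hb
    exact (reveals_var (hU (a b)) S S').1 (congrFun h ⟨a b, hb⟩) b (mem_content.2 rfl)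
  · intro h
    funext I
    refine (reveals_var (hU I) S S').2 fun b hb => ?_
    exact h b (by rw [mem_content.1 hb]; exact I.2)

lemma auxRate_eq {U : AuxChoice m s} {a : Fin s → Finset (Fin m)}
    (hU : ∀ I, U I = (content a I).image fun b => {b}) : P.auxRate U =
    ((∑ I : Finset (Fin m), I.sup fun i => (content a I \ P.side i).card : ℕ) : ℝ) := by
  rw [auxRate, Nat.cast_sum]
  refine Finset.sum_congr rfl fun I _ => ?_
  rw [← iSup_coe_eq_sup]
  exact iSup_congr fun i => condEntropy_of_reveals (reveals_var (hU I)) (reveals_bits _)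

/-- Distinct messages consist of disjoint sets of source bits, which gives both independence
properties. Decoding uses no side information here, as each decoder receives its demanded bits
uncoded. -/
theorem feasible_of_allocation {U : AuxChoice m s} {a : Fin s → Finset (Fin m)}
    (hU : ∀ I, U I = (content a I).image fun b => {b})
    (ha : ∀ α, ∀ b ∈ P.demand α, α ∈ a b) : P.Feasible U where
  decodable i := by
    refine exists_factor fun S S' h1 _ => ?_
    rw [reveals_jointVar hU] at h1
    rw [reveals_bits]
    intro b hb
    exact h1 b (by simp [ha i b hb])
  indep := mutuallyIndep_of_reveals (a := a) fun I => reveals_var (hU I)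
  condIndep J K L T hJK := by
    have hZ : RevealsExactly (fun S => (jointVar U L S, P.jointSide T S))
        ((Finset.univ.filter fun b => a b ∈ L) ∪ T.biUnion P.side) := by
      intro S S'
      simp only [Prod.mk.injEq, Finset.mem_union, or_imp, forall_and]
      rw [reveals_jointVar hU]
      refine and_congr Iff.rfl ⟨fun h b hb => ?_, fun h => ?_⟩
      · obtain ⟨i, hi, hb⟩ := Finset.mem_biUnion.1 hb
        exact (reveals_bits _ S S').1 (congrFun h ⟨i, hi⟩) b hb
      · funext i
        exact (reveals_bits _ S S').2 fun b hb => h b (Finset.mem_biUnion.2 ⟨i, i.2, hb⟩)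
    refine condIndep_of_reveals (reveals_jointVar hU J) (reveals_jointVar hU K) hZ ?_
    rw [Finset.disjoint_left]
    intro b hb hb'
    simp only [Finset.mem_filter, Finset.mem_univ, true_and] at hb hb'
    exact Finset.disjoint_left.1 hJK hb hb'

/-! ### The CAPM rate is at most the rate formula -/

variable {P}

lemma ExcessInvariant.mem_of_mem_demand {a : Fin s → Finset (Fin m)} (ha : P.ExcessInvariant a)
    (α : Fin m) (b : Fin s) (hb : b ∈ P.demand α) : α ∈ a b := by
  rcases ha.eq_or_eq b with h | h
  · rw [h]; exact P.mem_step1_of_mem_demand hb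
  · rw [h]; exact Finset.mem_univ α

/-- The excess bits not concerning Decoder `i` have a common demander. -/
lemma ExcessInvariant.exists_demander (hm : m ≤ 3) {a : Fin s → Finset (Fin m)}
    (ha : P.ExcessInvariant a) {i j₀ : Fin m} (hj₀ : j₀ ≠ i) :
    ∃ j, j ≠ i ∧ ∀ b, a b ≠ P.step1 b → i ∉ P.step1 b → b ∈ P.demand j := by
  by_cases h : ∃ b, a b ≠ P.step1 b ∧ i ∉ P.step1 b
  swap
  · push Not at h
    exact ⟨j₀, hj₀, fun b h1 h2 => absurd (h b h1) h2⟩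
  obtain ⟨b, hb, hi⟩ := h
  obtain ⟨j, hj⟩ := P.demanded b
  refine ⟨j, ?_, fun b' hb' hi' => ?_⟩
  · rintro rfl
    exact hi (P.mem_step1_of_mem_demand hj)
  refine ha.demand_eq b b' hb hb' ?_ j hj
  -- A message of Step 1 lacking `i` lacks nothing else, so there is only one such message.
  have hset : ∀ b, i ∉ P.step1 b → ∀ α, α ∈ P.step1 b ↔ α ≠ i := by
    intro b hib
    obtain ⟨d, c, x, -, -, -, -, -, hst, -⟩ :=
      P.step1_cases hm (b := b) (fun h => hib (h ▸ Finset.mem_univ i))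
    have : i = x := by
      by_contra h
      exact hib ((hst i).2 h)
    rw [this]
    exact hst
  ext α
  rw [hset b hi, hset b' hi']

/-- The bits that Decoder `i` misses in its messages, and `j` in the remaining message, are counted
by the rate at `i`. -/
lemma ExcessInvariant.mem_baseBits_union (hm : m ≤ 3) {a : Fin s → Finset (Fin m)}
    (ha : P.ExcessInvariant a) {i j : Fin m} (hji : j ≠ i)
    (hj : ∀ b, a b ≠ P.step1 b → i ∉ P.step1 b → b ∈ P.demand j) {b : Fin s}
    (hb : b ∉ P.side (if i ∈ a b then i else j)) :
    b ∈ P.baseBits i ∪ P.f {j} {i, j} := by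
  rw [Finset.mem_union]
  by_cases hu : P.step1 b = Finset.univ
  · have hab : a b = Finset.univ := by
      rcases ha.eq_or_eq b with h | h
      · rw [h, hu]
      · exact h
    rw [hab, if_pos (Finset.mem_univ i)] at hb
    by_cases hbi : b ∈ P.demand i
    · exact .inl (P.mem_baseBits.2 ⟨hb, .inl hbi⟩)
    obtain ⟨d, hd⟩ := P.demanded b
    have hdi : d ≠ i := by rintro rfl; exact hbi hd
    -- A top bit of Step 1 missed by `i` is a base bit unless it lies in `f {d} {i, d}`. In that
    -- case `d = j`; otherwise `j` would know it and Step 1 would have left `i` out of its message.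
    by_cases hmis : ∃ β, β ≠ d ∧ b ∈ P.f {d} {β, d}
    · obtain ⟨β, hβ, hf⟩ := hmis
      obtain ⟨h1, h2⟩ := P.mem_f_pair.1 hf
      have hβi : i = β := by
        rcases (h2 i).1 hb with h | h
        · exact h
        · exact absurd h.symm hdi
      subst hβi
      by_cases hdj : d = j
      · subst hdj; exact .inr hf
      have hjs : j ∈ P.step1 b := hu ▸ Finset.mem_univ j
      have his : i ∈ P.step1 b := hu ▸ Finset.mem_univ i
      have hjside : b ∈ P.side j := by
        by_contra h
        rcases (h2 j).1 h with h | h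
        · exact hji h
        · exact hdj h.symm
      have hne : P.missing b ≠ Finset.univ := fun h => by
        have : j ∈ P.missing b := h ▸ Finset.mem_univ j
        simp [missing, hjside] at this
      rw [step1, if_neg hne] at his
      simp [demanders, missing, hbi, hb] at his
    · push Not at hmis
      exact .inl (P.mem_baseBits.2 ⟨hb, .inr ⟨d, hdi, hd, hmis⟩⟩)
  · obtain ⟨d, c, x, hdc, hdx, hcx, hdem, hside, hst, hcov⟩ := P.step1_cases hm hu
    -- If `i` is the third decoder, the bit is demanded by `j`, whether it stayed in `{d, c}` and
    -- `j` misses it or it is excess. Otherwise `i` receives the bit and misses it, so `i` is its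
    -- demander.
    by_cases hix : i = x
    · subst hix
      have hbj : j = d := by
        by_cases hab : a b = P.step1 b
        · have : i ∉ a b := by rw [hab, hst]; simp
          rw [if_neg this, hside] at hb
          rcases hcov j with h | h | h
          · exact h
          · exact absurd h hb
          · exact absurd h hji
        · exact (hdem j).1 (hj b hab (by rw [hst]; simp))
      subst hbj
      refine .inr (P.mem_f_pair.2 ⟨hdem, fun α => ?_⟩)
      rw [hside]
      rcases hcov α with rfl | rfl | rfl
      · simp [hdc]
      · simp [hdc.symm, hcx]
      · simp [hcx.symm]
    · have hia : i ∈ a b := by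
        rcases ha.eq_or_eq b with h | h
        · rw [h, hst]; exact hix
        · rw [h]; exact Finset.mem_univ i
      rw [if_pos hia] at hb
      left
      refine P.mem_baseBits.2 ⟨hb, .inl ?_⟩
      rw [hside] at hb
      rw [hdem]
      rcases hcov i with h | h | h
      · exact h
      · exact absurd h hb
      · exact absurd h hix

/-- The witness `i` attains the maximum in the top message. Balance allows the cost of each lower
message to be read off at any member, so at `i` when possible and at `j` otherwise. -/
theorem ExcessInvariant.exists_le_rateAt (hm : m ≤ 3) {a : Fin s → Finset (Fin m)}
    (ha : P.ExcessInvariant a) (hbal : ∀ I, I ≠ Finset.univ → P.Balanced a I) (i₀ : Fin m) :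
    ∃ i, ((∑ I : Finset (Fin m), I.sup fun i => (content a I \ P.side i).card : ℕ) : ℝ) ≤
      P.rateAt i := by
  classical
  obtain ⟨i, -, hi⟩ := Finset.exists_mem_eq_sup Finset.univ ⟨i₀, Finset.mem_univ i₀⟩
    fun i => (content a Finset.univ \ P.side i).card
  refine ⟨i, ?_⟩
  rw [rateAt_eq]
  refine Nat.cast_le.2 ?_
  have hsum : ∀ j : Fin m, (∀ b, a b ≠ Finset.univ → i ∈ a b ∨ j ∈ a b) →
      (∑ I : Finset (Fin m), I.sup fun i => (content a I \ P.side i).card) ≤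
      (Finset.univ.filter fun b => b ∉ P.side (if i ∈ a b then i else j)).card := by
    intro j hj
    rw [Finset.card_eq_sum_card_fiberwise (f := a) (t := Finset.univ)
      (fun b _ => Finset.mem_coe.2 (Finset.mem_univ _))]
    refine Finset.sum_le_sum fun I _ => ?_
    have hfib : ((Finset.univ.filter fun b => b ∉ P.side (if i ∈ a b then i else j)).filter
        fun b => a b = I) = content a I \ P.side (if i ∈ I then i else j) := by
      ext b
      simp only [Finset.mem_filter, Finset.mem_univ, true_and, Finset.mem_sdiff, mem_content]
      constructor
      · rintro ⟨h, rfl⟩; exact ⟨rfl, h⟩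
      · rintro ⟨rfl, h⟩; exact ⟨h, rfl⟩
    rw [hfib]
    by_cases hI : I = Finset.univ
    · subst hI
      rw [if_pos (Finset.mem_univ i), hi]
    rcases (content a I).eq_empty_or_nonempty with he | ⟨b, hb⟩
    · rw [he]; simp
    refine Finset.sup_le fun l hl => (hbal I hI l hl _ ?_).le
    have hab := mem_content.1 hb
    have := hj b (hab ▸ hI)
    rw [hab] at this
    split_ifs with h
    · exact h
    · exact this.resolve_left h
  by_cases hj₀ : ∃ j₀ : Fin m, j₀ ≠ i
  · obtain ⟨j₀, hj₀⟩ := hj₀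
    obtain ⟨j, hji, hj⟩ := ha.exists_demander hm hj₀
    refine (hsum j fun b hb => ?_).trans ?_
    · have hab := (ha.eq_or_eq b).resolve_right hb
      obtain ⟨d, c, x, -, -, -, -, -, hst, -⟩ := P.step1_cases hm (hab ▸ hb)
      rw [hab, hst, hst]
      by_contra h
      push Not at h
      exact hji (h.2.trans h.1.symm)
    · calc _ ≤ (P.baseBits i ∪ P.f {j} {i, j}).card :=
            Finset.card_le_card fun b hb =>
              ha.mem_baseBits_union hm hji hj (Finset.mem_filter.1 hb).2
        _ ≤ (P.baseBits i).card + (P.f {j} {i, j}).card := Finset.card_union_le _ _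
        _ ≤ _ := Nat.add_le_add_left (Finset.le_sup (f := fun j => (P.f {j} {i, j}).card)
            (Finset.mem_erase.2 ⟨hji, Finset.mem_univ j⟩)) _
  -- With a single decoder every bit is demanded by `i`, so the base bits are all the bits.
  · push Not at hj₀
    have hmem : ∀ b, i ∈ a b := fun b => by
      obtain ⟨α, hα⟩ := P.demanded b
      exact hj₀ α ▸ ha.mem_of_mem_demand α b hα
    refine (hsum i fun b _ => .inl (hmem b)).trans (le_add_right (Finset.card_le_card ?_))
    intro b hb
    obtain ⟨α, hα⟩ := P.demanded b
    rw [hj₀ α] at hα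
    exact P.mem_baseBits.2 ⟨P.notMem_side_of_mem_demand hα, .inl hα⟩

theorem ExcessInvariant.le_maxRate (hm : m ≤ 3) {a : Fin s → Finset (Fin m)}
    (ha : P.ExcessInvariant a) (hbal : ∀ I, I ≠ Finset.univ → P.Balanced a I) :
    ((∑ I : Finset (Fin m), I.sup fun i => (content a I \ P.side i).card : ℕ) : ℝ) ≤
      P.maxRate := by
  rcases isEmpty_or_nonempty (Fin m) with hE | ⟨⟨i₀⟩⟩
  · rw [maxRate, Real.iSup_of_isEmpty]
    refine le_of_eq (Nat.cast_eq_zero.2 (Finset.sum_eq_zero fun I _ => ?_))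
    rw [Finset.eq_empty_of_isEmpty I]
    simp
  · obtain ⟨i, hi⟩ := ha.exists_le_rateAt hm hbal i₀
    exact hi.trans (le_ciSup (f := P.rateAt) (Set.finite_range _).bddAbove i)

end IndexCodingProblem

end

/-! ### The optimal rate for at most three decoders -/

theorem corollary1 {m s : ℕ} (hm : m ≤ 3) (P : IndexCodingProblem m s) :
    IsGLB {R : ℝ | P.Achievable R} P.optimalRate ∧
      P.optimalRate = P.maxRate ∧
      (∃ k : ℤ, P.optimalRate = (k : ℝ)) ∧
      (∃ U : AuxChoice m s, P.IsCAPMOutput U) ∧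
      ∀ U : AuxChoice m s, P.IsCAPMOutput U →
        P.Feasible U ∧ P.auxRate U = P.optimalRate ∧ P.Achievable (P.auxRate U) := by
  have hout : ∀ U : AuxChoice m s, P.IsCAPMOutput U → P.Feasible U ∧ P.auxRate U = P.maxRate ∧
      P.Achievable (P.auxRate U) ∧ ∃ k : ℤ, P.auxRate U = (k : ℝ) := by
    intro U hU
    obtain ⟨a, ha, hbal, hUa⟩ := hU.spec hm
    have hrate := P.auxRate_eq hUa
    have hach := P.achievable_of_allocation hm a ha.mem_of_mem_demand
    refine ⟨P.feasible_of_allocation hUa ha.mem_of_mem_demand, ?_, by rwa [hrate],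
      _, hrate.trans (Int.cast_natCast _).symm⟩
    rw [hrate]
    exact le_antisymm (ha.le_maxRate hm hbal) (P.maxRate_le_of_achievable hm hach)
  obtain ⟨U, hU⟩ := P.exists_isCAPMOutput
  obtain ⟨-, hmax, hach, k, hk⟩ := hout U hU
  -- The rate of any one output is achievable and meets the converse, so the infimum is attained.
  have hleast : IsLeast {R : ℝ | P.Achievable R} P.maxRate :=
    ⟨hmax ▸ hach, fun R hR => P.maxRate_le_of_achievable hm hR⟩
  have hopt : P.optimalRate = P.maxRate := hleast.csInf_eq
  refine ⟨hopt ▸ hleast.isGLB, hopt, ⟨k, by rw [hopt, ← hmax, hk]⟩, ⟨U, hU⟩, fun U' hU' => ?_⟩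
  obtain ⟨h1, h2, h3, -⟩ := hout U' hU'
  exact ⟨h1, h2.trans hopt.symm, h3⟩
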